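/- **Setting.** Let $\mathbf A=(a_{ij})_{i,j\in\mathbf I}$ be an indecomposable symmetrizable generalized Cartan matrix ($\mathbf I$ finite), $(\mathfrak h,\{\alpha_i\},\{\alpha_i^\vee\})$ a realization of it over $\mathbb C$ (so $\alpha_j(\alpha_i^\vee)=a_{ij}$, both families are linearly independent and $\dim\mathfrak h=2|\mathbf I|-\operatorname{rank}\mathbf A$), and $d_i$ the positive relatively prime integers with $d_ia_{ij}=d_ja_{ji}$; put $d_{ij}=d_ia_{ij}/2$. Let $\mathfrak g$ be the associated symmetrizable Kac–Moody algebra, generated by $\mathfrak h$ and Chevalley generators $e_i,f_i$ with the Chevalley–Serre relations, and set $x_i^+=\sqrt{d_i}\,e_i$, $x_i^-=\sqrt{d_i}\,f_i$, $h_i=d_i\alpha_i^\vee$. For $\mathsf Z=\mathbb N$ or $\mathbb Z$ consider the unital associative $\mathbb C[\hbar]$-algebra generated by the vector space $\mathfrak h$ and elements $x_{ir}^\pm,h_{ir}$ ($i\in\mathbf I$, $r\in\mathsf Z$), with relations, for $h,h'\in\mathfrak h$ and all indices, $$h_{i0}=d_i\alpha_i^\vee,\quad [h_{ir},h_{js}]=[h_{ir},h]=[h,h']=0,\quad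 [h,x_{js}^\pm]=\pm\alpha_j(h)x_{js}^\pm,\quad [x_{ir}^+,x_{js}^-]=\delta_{ij}h_{i,r+s},$$ $$[h_{i,r+1},x_{js}^\pm]-[h_{ir},x_{j,s+1}^\pm]=\pm\hbar d_{ij}(h_{ir}x_{js}^\pm+x_{js}^\pm h_{ir}),$$ $$[x_{i,r+1}^\pm,x_{js}^\pm]-[x_{ir}^\pm,x_{j,s+1}^\pm]=\pm\hbar d_{ij}(x_{ir}^\pm x_{js}^\pm+x_{js}^\pm x_{ir}^\pm),$$ $$\sum_{\pi\in S_m}[x_{i,r_{\pi(1)}}^\pm,[x_{i,r_{\pi(2)}}^\pm,\ldots,[x_{i,r_{\pi(m)}}^\pm,x_{js}^\pm]\cdots]]=0\qquad(i\ne j,\ m=1-a_{ij}).$$ For $\mathsf Z=\mathbb N$ this is the Yangian $Y_\hbar\mathfrak g$. For $\mathsf Z=\mathbb Z$, with generators written $\mathcal X_{ir}^\pm,\mathcal H_{ir}$, its $\hbar$-adic completion is the Yangian double $\mathrm DY_\hbar\mathfrak g$, a $\mathbb C[\![\hbar]\!]$-algebra. Let $\iota:Y_\hbar\mathfrak g\to\mathrm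 DY_\hbar\mathfrak g$ be the natural homomorphism $h\mapsto h$, $x_{ir}^\pm\mapsto\mathcal X_{ir}^\pm$, $h_{ir}\mapsto\mathcal H_{ir}$. The *evaluation ideals at $t=1$*, $\mathcal J\subset\mathrm DY_\hbar\mathfrak g$ and $\mathcal J_+\subset Y_\hbar\mathfrak g$, are the kernels of the homomorphisms to $U(\mathfrak g)$ given by $\hbar\mapsto0$, $h\mapsto h$, $\mathcal X_{ir}^\pm\mapsto x_i^\pm$, $\mathcal H_{ir}\mapsto h_i$ (all $r\in\mathbb Z$), respectively $\hbar\mapsto 0$, $h\mapsto h$, $x_{ir}^\pm\mapsto x_i^\pm$, $h_{ir}\mapsto h_i$ (all $r\in\mathbb N$). Put $$\widehat{\mathrm DY_\hbar\mathfrak g}=\varprojlim_n\mathrm DY_\hbar\mathfrak g/\mathcal J^n,\qquad \widehat{Y_\hbar\mathfrak g}_\times=\varprojlim_nY_\hbar\mathfrak g/\mathcal J_+^n,\qquad \widehat{Y_\hbar\mathfrak g}=\prod_{k\in\mathbb N}(Y_\hbar\mathfrak g)_k=\varprojlim_nY_\hbar\mathfrak g\Big/\bigoplus_{k\ge n}(Y_\hbar\mathfrak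 g)_k,$$ where $(Y_\hbar\mathfrak g)_k$ is the component of degree $k$ for the grading $\deg\hbar=1$, $\deg\mathfrak h=0$, $\deg x_{ir}^\pm=\deg h_{ir}=r$. All three are $\mathbb C[\![\hbar]\!]$-algebras. For $c\in\mathbb C$ let $\tau_c:Y_\hbar\mathfrak g\to Y_\hbar\mathfrak g$ be the shift homomorphism $h\mapsto h$, $x_{ir}^\pm\mapsto\sum_{k=0}^r\binom rk c^{r-k}x_{ik}^\pm$, $h_{ir}\mapsto\sum_{k=0}^r\binom rk c^{r-k}h_{ik}$. Let $\Phi:\mathrm DY_\hbar\mathfrak g\to\widehat{Y_\hbar\mathfrak g}$ be the homomorphism of $\mathbb C[\![\hbar]\!]$-algebras extending $\tau_1$ given by $h\mapsto h$, $\mathcal X_{ir}^\pm\mapsto\sum_{n\ge0}\binom rn x_{in}^\pm$, $\mathcal H_{ir}\mapsto\sum_{n\ge0}\binom rn h_{in}$ ($r\in\mathbb Z$). **Corollary.** For every $n\in\mathbb N$ one has $\iota(\mathcal J_+^n)\subset\mathcal J^n$, $\ \tau_{-1}\big(\bigoplus_{k\ge n}(Y_\hbar\mathfrak g)_k\big)\subset\mathcal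 J_+^n$ and $\Phi(\mathcal J^n)\subset\prod_{k\ge n}(Y_\hbar\mathfrak g)_k$. The maps induced by $\iota$, $\tau_{-1}$ and $\Phi$ on completions, $$\widehat\iota:\widehat{Y_\hbar\mathfrak g}_\times\to\widehat{\mathrm DY_\hbar\mathfrak g},\qquad \widehat{\mathsf\Gamma}:\widehat{Y_\hbar\mathfrak g}\to\widehat{Y_\hbar\mathfrak g}_\times,\qquad \widehat\Phi:\widehat{\mathrm DY_\hbar\mathfrak g}\to\widehat{Y_\hbar\mathfrak g},$$ are homomorphisms of $\mathbb C[\![\hbar]\!]$-algebras, $\widehat{\mathsf\Gamma}$ is an isomorphism, and $\widehat\iota$ and $\widehat{\mathsf\Gamma}\circ\widehat\Phi$ are mutual inverses. In particular $\widehat\iota$ is an isomorphism of $\mathbb C[\![\hbar]\!]$-algebras. -/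

import Mathlib

namespace KacMoodyYangian

open Polynomial

noncomputable section

/-- A symmetrizable generalized Cartan matrix `A`, indecomposable, together with the normalized
symmetrizing integers `d` and a realization `(𝔥, α, α^∨)` of `A` over `ℂ`, of dimension
`2 |I| - rank A`. The standard invariant form satisfies `(α_i, α_j) = d_i a_ij`, so that
`(α_i, α_i) / 2 = d_i`. -/
structure Datum (I 𝔥 : Type*) [Fintype I] [DecidableEq I] [AddCommGroup 𝔥] [Module ℂ 𝔥] where
  A : Matrix I I ℤ
  diag : ∀ i, A i i = 2
  offDiag : ∀ i j, i ≠ j → A i j ≤ 0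
  zero_symm : ∀ i j, A i j = 0 → A j i = 0
  indecomposable : ∀ S : Set I, S.Nonempty → Sᶜ.Nonempty → ∃ i ∈ S, ∃ j ∈ Sᶜ, A i j ≠ 0
  d : I → ℕ
  d_pos : ∀ i, 0 < d i
  d_gcd : Finset.univ.gcd d = 1
  symm : ∀ i j, (d i : ℤ) * A i j = (d j : ℤ) * A j i
  root : I → Module.Dual ℂ 𝔥
  coroot : I → 𝔥
  root_coroot : ∀ i j, root j (coroot i) = (A i j : ℂ)
  root_li : LinearIndependent ℂ root
  coroot_li : LinearIndependent ℂ coroot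
  finrank_add_rank :
    Module.finrank ℂ 𝔥 + (A.map (Int.cast : ℤ → ℂ)).rank = 2 * Fintype.card I

variable {I 𝔥 : Type*} [Fintype I] [DecidableEq I] [AddCommGroup 𝔥] [Module ℂ 𝔥]

/-- `d_ij = (α_i, α_j) / 2`. -/
def Datum.dd (D : Datum I 𝔥) (i j : I) : ℂ := (D.d i : ℂ) * (D.A i j : ℂ) / 2

/-! ### The Kac-Moody algebra and its enveloping algebra -/

/-- Chevalley generators. -/
inductive ChevalleyGen (I 𝔥 : Type*)
  | cartan (a : 𝔥) : ChevalleyGen I 𝔥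
  | e (i : I) : ChevalleyGen I 𝔥
  | f (i : I) : ChevalleyGen I 𝔥

/-- The free Lie algebra on the set `𝔥 ∪ {e_i, f_i}`. -/
abbrev FreeLie (I 𝔥 : Type*) := FreeLieAlgebra ℂ (ChevalleyGen I 𝔥)

abbrev Datum.lc (_ : Datum I 𝔥) (a : 𝔥) : FreeLie I 𝔥 := FreeLieAlgebra.of ℂ (.cartan a)
abbrev Datum.le (_ : Datum I 𝔥) (i : I) : FreeLie I 𝔥 := FreeLieAlgebra.of ℂ (.e i)
abbrev Datum.lf (_ : Datum I 𝔥) (i : I) : FreeLie I 𝔥 := FreeLieAlgebra.of ℂ (.f i)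

/-- The Chevalley-Serre relators (the first two express that `𝔥` embeds linearly). -/
inductive Datum.Relator (D : Datum I 𝔥) : FreeLie I 𝔥 → Prop
  | add (a b : 𝔥) : D.Relator (D.lc (a + b) - (D.lc a + D.lc b))
  | smul (c : ℂ) (a : 𝔥) : D.Relator (D.lc (c • a) - c • D.lc a)
  | comm (a b : 𝔥) : D.Relator ⁅D.lc a, D.lc b⁆
  | cartan_e (a : 𝔥) (i : I) : D.Relator (⁅D.lc a, D.le i⁆ - D.root i a • D.le i)
  | cartan_f (a : 𝔥) (i : I) : D.Relator (⁅D.lc a, D.lf i⁆ + D.root i a • D.lf i)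
  | e_f (i j : I) : D.Relator (⁅D.le i, D.lf j⁆ - if i = j then D.lc (D.coroot i) else 0)
  | serre_e (i j : I) (hij : i ≠ j) :
      D.Relator (((LieAlgebra.ad ℂ (FreeLie I 𝔥) (D.le i)) ^ (1 - D.A i j).toNat) (D.le j))
  | serre_f (i j : I) (hij : i ≠ j) :
      D.Relator (((LieAlgebra.ad ℂ (FreeLie I 𝔥) (D.lf i)) ^ (1 - D.A i j).toNat) (D.lf j))

/-- The ideal generated by the Chevalley-Serre relators. -/
def Datum.serreIdeal (D : Datum I 𝔥) : LieIdeal ℂ (FreeLie I 𝔥) :=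
  LieSubmodule.lieSpan ℂ (FreeLie I 𝔥) {x | D.Relator x}

/-- The symmetrizable Kac-Moody algebra `𝔤`, in its Chevalley-Serre presentation. -/
abbrev Datum.LieAlg (D : Datum I 𝔥) := FreeLie I 𝔥 ⧸ D.serreIdeal

/-- `U(𝔤)`. -/
abbrev Datum.U (D : Datum I 𝔥) := UniversalEnvelopingAlgebra ℂ D.LieAlg

/-- The canonical map from the free Lie algebra to `U(𝔤)`. -/
def Datum.toU (D : Datum I 𝔥) (x : FreeLie I 𝔥) : D.U :=
  UniversalEnvelopingAlgebra.ι ℂ (LieSubmodule.Quotient.mk' D.serreIdeal x)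

/-- `x_i^+ = √d_i e_i` and `x_i^- = √d_i f_i` in `U(𝔤)`. -/
def Datum.ux (D : Datum I 𝔥) (ε : ℤˣ) (i : I) : D.U :=
  ((Real.sqrt (D.d i) : ℝ) : ℂ) • D.toU (if ε = 1 then D.le i else D.lf i)

/-! ### Yangian-type algebras -/

/-- Generators of the Yangian (`Z = ℕ`) and of the `ℂ[ħ]`-form of its double (`Z = ℤ`):
`h ∈ 𝔥`, `x_{ir}^ε` with `ε = ±1`, and `h_{ir}`. -/
inductive Gen (I 𝔥 Z : Type*)
  | cartan (a : 𝔥) : Gen I 𝔥 Z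
  | x (ε : ℤˣ) (i : I) (r : Z) : Gen I 𝔥 Z
  | h (i : I) (r : Z) : Gen I 𝔥 Z

/-- `[y_1, [y_2, …, [y_m, z]…]]`. -/
def nested {B : Type*} [Ring B] {m : ℕ} (y : Fin m → B) (z : B) : B :=
  (List.ofFn y).foldr (fun a b => ⁅a, b⁆) z

/-- The complex number `c` as an element of `ℂ[ħ]`. -/
abbrev sc (c : ℂ) : ℂ[X] := C c

/-- `ħ ∈ ℂ[ħ]`. -/
abbrev hbar : ℂ[X] := X

/-- The sign `ε = ±1` as a complex number. -/
abbrev sg (ε : ℤˣ) : ℂ := ((ε : ℤ) : ℂ)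

/-- The defining relations, for a family `g` of elements of a `ℂ[ħ]`-algebra `B` indexed by the
generators; `Rel D g a b` means that `a = b` is one of the relations. -/
inductive Rel (D : Datum I 𝔥) {Z : Type*} [AddMonoidWithOne Z] {B : Type*} [Ring B]
    [Algebra ℂ[X] B] (g : Gen I 𝔥 Z → B) : B → B → Prop
  | add (a b : 𝔥) : Rel D g (g (.cartan (a + b))) (g (.cartan a) + g (.cartan b))
  | smul (c : ℂ) (a : 𝔥) : Rel D g (g (.cartan (c • a))) (sc c • g (.cartan a))
  | h_zero (i : I) : Rel D g (g (.h i 0)) (g (.cartan ((D.d i : ℂ) • D.coroot i)))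
  | hh (i j : I) (r s : Z) : Rel D g ⁅g (.h i r), g (.h j s)⁆ 0
  | h_cartan (i : I) (r : Z) (a : 𝔥) : Rel D g ⁅g (.h i r), g (.cartan a)⁆ 0
  | cartan_cartan (a b : 𝔥) : Rel D g ⁅g (.cartan a), g (.cartan b)⁆ 0
  | cartan_x (a : 𝔥) (ε : ℤˣ) (j : I) (s : Z) :
      Rel D g ⁅g (.cartan a), g (.x ε j s)⁆ (sc (sg ε * D.root j a) • g (.x ε j s))
  | x_x (i j : I) (r s : Z) :
      Rel D g ⁅g (.x 1 i r), g (.x (-1) j s)⁆ (if i = j then g (.h i (r + s)) else 0)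
  | h_x (i j : I) (ε : ℤˣ) (r s : Z) :
      Rel D g (⁅g (.h i (r + 1)), g (.x ε j s)⁆ - ⁅g (.h i r), g (.x ε j (s + 1))⁆)
        ((hbar * sc (sg ε * D.dd i j)) •
          (g (.h i r) * g (.x ε j s) + g (.x ε j s) * g (.h i r)))
  | xx (i j : I) (ε : ℤˣ) (r s : Z) :
      Rel D g (⁅g (.x ε i (r + 1)), g (.x ε j s)⁆ - ⁅g (.x ε i r), g (.x ε j (s + 1))⁆)
        ((hbar * sc (sg ε * D.dd i j)) •
          (g (.x ε i r) * g (.x ε j s) + g (.x ε j s) * g (.x ε i r)))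
  | serre (i j : I) (hij : i ≠ j) (ε : ℤˣ) (r : Fin (1 - D.A i j).toNat → Z) (s : Z) :
      Rel D g (∑ π : Equiv.Perm (Fin (1 - D.A i j).toNat),
        nested (fun k => g (.x ε i (r (π k)))) (g (.x ε j s))) 0

/-- The `ℂ[ħ]`-algebra with the above generators and relations, modes running through `Z`. -/
def Alg (D : Datum I 𝔥) (Z : Type*) [AddMonoidWithOne Z] : Type _ :=
  RingQuot (Rel D (FreeAlgebra.ι ℂ[X] : Gen I 𝔥 Z → FreeAlgebra ℂ[X] (Gen I 𝔥 Z)))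

section
variable (D : Datum I 𝔥) (Z : Type*) [AddMonoidWithOne Z]

instance : Ring (Alg D Z) := inferInstanceAs (Ring (RingQuot _))
instance : Algebra ℂ[X] (Alg D Z) := inferInstanceAs (Algebra ℂ[X] (RingQuot _))

/-- The generators. -/
def Alg.gen (g : Gen I 𝔥 Z) : Alg D Z :=
  RingQuot.mkAlgHom ℂ[X] (Rel D (FreeAlgebra.ι ℂ[X])) (FreeAlgebra.ι ℂ[X] g)
end

variable {D : Datum I 𝔥} {Z : Type*} [AddMonoidWithOne Z]

theorem map_bracket' {B B' F : Type*} [Ring B] [Ring B'] [FunLike F B B'] [RingHomClass F B B']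
    (φ : F) (a b : B) : φ ⁅a, b⁆ = ⁅φ a, φ b⁆ := by
  simp [Ring.lie_def]

theorem map_nested {B B' F : Type*} [Ring B] [Ring B'] [FunLike F B B'] [RingHomClass F B B']
    (φ : F) {m : ℕ} (y : Fin m → B) (z : B) :
    φ (nested y z) = nested (fun k => φ (y k)) (φ z) := by
  have h : ∀ l : List B, φ (l.foldr (fun a b => ⁅a, b⁆) z) =
      (l.map φ).foldr (fun a b => ⁅a, b⁆) (φ z) := by
    intro l
    induction l with
    | nil => simp
    | cons a l ih => simp [map_bracket', ih]
  unfold nested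
  rw [h, List.map_ofFn]
  rfl

theorem Rel.map {B B' : Type*} [Ring B] [Algebra ℂ[X] B] [Ring B'] [Algebra ℂ[X] B']
    {g : Gen I 𝔥 Z → B} (φ : B →ₐ[ℂ[X]] B') {a b : B} (h : Rel D g a b) :
    Rel D (fun k => φ (g k)) (φ a) (φ b) := by
  cases h with
  | add a b => simpa using Rel.add (D := D) (g := fun k => φ (g k)) a b
  | smul c a => simpa using Rel.smul (D := D) (g := fun k => φ (g k)) c a
  | h_zero i => simpa using Rel.h_zero (D := D) (g := fun k => φ (g k)) i
  | hh i j r s => simpa [map_bracket'] using Rel.hh (D := D) (g := fun k => φ (g k)) i j r s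
  | h_cartan i r a =>
    simpa [map_bracket'] using Rel.h_cartan (D := D) (g := fun k => φ (g k)) i r a
  | cartan_cartan a b =>
    simpa [map_bracket'] using Rel.cartan_cartan (D := D) (g := fun k => φ (g k)) a b
  | cartan_x a ε j s =>
    simpa only [map_bracket', map_smul] using
      Rel.cartan_x (D := D) (g := fun k => φ (g k)) a ε j s
  | x_x i j r s =>
    have := Rel.x_x (D := D) (g := fun k => φ (g k)) i j r s
    simpa only [map_bracket', apply_ite φ, map_zero] using this
  | h_x i j ε r s =>
    simpa only [map_bracket', map_smul, map_sub, map_add, map_mul] using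
      Rel.h_x (D := D) (g := fun k => φ (g k)) i j ε r s
  | xx i j ε r s =>
    simpa only [map_bracket', map_smul, map_sub, map_add, map_mul] using
      Rel.xx (D := D) (g := fun k => φ (g k)) i j ε r s
  | serre i j hij ε r s =>
    simpa only [map_sum, map_nested, map_zero] using
      Rel.serre (D := D) (g := fun k => φ (g k)) i j hij ε r s

/-- The homomorphism determined by a family of elements satisfying the defining relations. -/
def Alg.lift {B : Type*} [Ring B] [Algebra ℂ[X] B] (g : Gen I 𝔥 Z → B)
    (hg : ∀ a b, Rel D g a b → a = b) : Alg D Z →ₐ[ℂ[X]] B :=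
  RingQuot.liftAlgHom ℂ[X] ⟨FreeAlgebra.lift ℂ[X] g, fun a b h => hg _ _ <| by
    simpa using h.map (FreeAlgebra.lift ℂ[X] g)⟩

theorem Alg.lift_gen {B : Type*} [Ring B] [Algebra ℂ[X] B] (g : Gen I 𝔥 Z → B)
    (hg : ∀ a b, Rel D g a b → a = b) (k : Gen I 𝔥 Z) :
    Alg.lift g hg (Alg.gen D Z k) = g k := by
  unfold Alg.lift Alg.gen
  erw [RingQuot.liftAlgHom_mkAlgHom_apply]
  simp

theorem Rel.exists_lift {B B' : Type*} [Ring B] [Algebra ℂ[X] B] [Ring B'] [Algebra ℂ[X] B']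
    {g : Gen I 𝔥 Z → B} (φ : B →ₐ[ℂ[X]] B') {a b : B'} (h : Rel D (fun k => φ (g k)) a b) :
    ∃ a' b', Rel D g a' b' ∧ φ a' = a ∧ φ b' = b := by
  cases h with
  | add a b => exact ⟨_, _, .add a b, by simp, by simp⟩
  | smul c a => exact ⟨_, _, .smul c a, by simp, by simp⟩
  | h_zero i => exact ⟨_, _, .h_zero i, by simp, by simp⟩
  | hh i j r s => exact ⟨_, _, .hh i j r s, by simp [map_bracket'], by simp⟩
  | h_cartan i r a => exact ⟨_, _, .h_cartan i r a, by simp [map_bracket'], by simp⟩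
  | cartan_cartan a b => exact ⟨_, _, .cartan_cartan a b, by simp [map_bracket'], by simp⟩
  | cartan_x a ε j s =>
    exact ⟨_, _, .cartan_x a ε j s, by simp only [map_bracket'], by simp only [map_smul]⟩
  | x_x i j r s =>
    exact ⟨_, _, .x_x i j r s, by simp only [map_bracket'], by simp only [apply_ite φ, map_zero]⟩
  | h_x i j ε r s =>
    exact ⟨_, _, .h_x i j ε r s, by simp only [map_bracket', map_sub],
      by simp only [map_smul, map_add, map_mul]⟩
  | xx i j ε r s =>
    exact ⟨_, _, .xx i j ε r s, by simp only [map_bracket', map_sub],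
      by simp only [map_smul, map_add, map_mul]⟩
  | serre i j hij ε r s =>
    exact ⟨_, _, .serre i j hij ε r s, by simp only [map_sum, map_nested], map_zero _⟩

theorem Alg.gen_rel (a b : Alg D Z) (h : Rel D (Alg.gen D Z) a b) : a = b := by
  let φ : FreeAlgebra ℂ[X] (Gen I 𝔥 Z) →ₐ[ℂ[X]] Alg D Z :=
    RingQuot.mkAlgHom ℂ[X] (Rel D (FreeAlgebra.ι ℂ[X] : Gen I 𝔥 Z → _))
  obtain ⟨a', b', h', ha, hb⟩ :=
    Rel.exists_lift (D := D) (g := (FreeAlgebra.ι ℂ[X] : Gen I 𝔥 Z → _)) φ h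
  rw [← ha, ← hb]
  exact RingQuot.mkAlgHom_rel _ h'

/-! ### The natural map, and evaluation at `t = 1` -/

/-- The Yangian `Y_ħ 𝔤`. -/
abbrev Yangian (D : Datum I 𝔥) := Alg D ℕ

/-- The `ℂ[ħ]`-form of the Yangian double. -/
abbrev DoubleForm (D : Datum I 𝔥) := Alg D ℤ

/-- The inclusion of the modes in `ℕ` into the modes in `ℤ`. -/
def castGen : Gen I 𝔥 ℕ → Gen I 𝔥 ℤ
  | .cartan a => .cartan a
  | .x ε i r => .x ε i r
  | .h i r => .h i r

theorem castGen_rel (a b : DoubleForm D)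
    (h : Rel D (fun k : Gen I 𝔥 ℕ => Alg.gen D ℤ (castGen k)) a b) : a = b := by
  apply Alg.gen_rel
  cases h with
  | add a b => exact .add a b
  | smul c a => exact .smul c a
  | h_zero i => exact .h_zero i
  | hh i j r s => exact Rel.hh (D := D) (g := Alg.gen D ℤ) i j r s
  | h_cartan i r a => exact Rel.h_cartan (D := D) (g := Alg.gen D ℤ) i r a
  | cartan_cartan a b => exact Rel.cartan_cartan (D := D) (g := Alg.gen D ℤ) a b
  | cartan_x a ε j s => exact Rel.cartan_x (D := D) (g := Alg.gen D ℤ) a ε j s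
  | x_x i j r s => simpa [castGen] using Rel.x_x (D := D) (g := Alg.gen D ℤ) i j r s
  | h_x i j ε r s => simpa [castGen] using Rel.h_x (D := D) (g := Alg.gen D ℤ) i j ε r s
  | xx i j ε r s => simpa [castGen] using Rel.xx (D := D) (g := Alg.gen D ℤ) i j ε r s
  | serre i j hij ε r s =>
    exact Rel.serre (D := D) (g := Alg.gen D ℤ) i j hij ε (fun k => (r k : ℤ)) s

variable (D) in
/-- The natural homomorphism from the Yangian to the `ℂ[ħ]`-form of the double. -/
def iotaForm : Yangian D →ₐ[ℂ[X]] DoubleForm D :=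
  Alg.lift (fun k => Alg.gen D ℤ (castGen k)) castGen_rel

variable (D) in
/-- `U(𝔤)` as a `ℂ[ħ]`-algebra on which `ħ` acts by `0`. -/
@[reducible] def evalAlgebra : Algebra ℂ[X] D.U :=
  ((algebraMap ℂ D.U).comp (Polynomial.evalRingHom 0)).toAlgebra' fun c x =>
    Algebra.commutes (Polynomial.evalRingHom 0 c) x

section Eval

attribute [local instance] evalAlgebra
attribute [local instance 100] LieRing.ofAssociativeRing

variable (D Z) in
/-- Values on generators of `ħ ↦ 0` followed by evaluation at `t = 1`: the classical limits of
`x_{ir}^±`, `h_{ir}` are `x_i^± t^r`, `h_i t^r` with `h_i = d_i α_i^∨`. -/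
def evalGen : Gen I 𝔥 Z → D.U
  | .cartan a => D.toU (D.lc a)
  | .x ε i _ => D.ux ε i
  | .h i _ => D.toU (D.lc ((D.d i : ℂ) • D.coroot i))

theorem sc_smul_U (c : ℂ) (x : D.U) : (C c : ℂ[X]) • x = c • x := by
  rw [Algebra.smul_def, Algebra.smul_def]
  change (algebraMap ℂ D.U) (Polynomial.evalRingHom 0 (C c)) * x = _
  simp

theorem hbar_smul_U (c : ℂ[X]) (x : D.U) : ((X : ℂ[X]) * c) • x = 0 := by
  rw [Algebra.smul_def]
  change (algebraMap ℂ D.U) (Polynomial.evalRingHom 0 (X * c)) * x = _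
  simp

theorem toU_add (a b : FreeLie I 𝔥) : D.toU (a + b) = D.toU a + D.toU b := by
  simp [Datum.toU]

theorem toU_sub (a b : FreeLie I 𝔥) : D.toU (a - b) = D.toU a - D.toU b := by
  simp [Datum.toU]

theorem toU_smul (c : ℂ) (b : FreeLie I 𝔥) : D.toU (c • b) = c • D.toU b := by
  simp [Datum.toU]

theorem toU_zero : D.toU (0 : FreeLie I 𝔥) = 0 := by
  simp [Datum.toU]

theorem toU_bracket (a b : FreeLie I 𝔥) : D.toU ⁅a, b⁆ = ⁅D.toU a, D.toU b⁆ := by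
  unfold Datum.toU
  rw [LieSubmodule.Quotient.mk'_apply, LieSubmodule.Quotient.mk_bracket]
  exact LieHom.map_lie _ _ _

theorem toU_relator {a : FreeLie I 𝔥} (h : D.Relator a) : D.toU a = 0 := by
  have : LieSubmodule.Quotient.mk' D.serreIdeal a = 0 := by
    rw [LieSubmodule.Quotient.mk'_apply, LieSubmodule.Quotient.mk_eq_zero']
    exact LieSubmodule.subset_lieSpan h
  unfold Datum.toU
  rw [this, map_zero]

theorem toU_ad_pow (a b : FreeLie I 𝔥) (m : ℕ) :
    D.toU (((LieAlgebra.ad ℂ (FreeLie I 𝔥) a) ^ m) b) = nested (fun _ : Fin m => D.toU a)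
      (D.toU b) := by
  induction m with
  | zero => simp [nested]
  | succ m ih =>
    rw [pow_succ', Module.End.mul_apply, LieAlgebra.ad_apply, toU_bracket, ih]
    simp [nested]

theorem nested_smul {B : Type*} [Ring B] [Algebra ℂ B] (c : ℂ) {m : ℕ} (y z : B) :
    nested (fun _ : Fin m => c • y) z = c ^ m • nested (fun _ : Fin m => y) z := by
  induction m with
  | zero => simp [nested]
  | succ m ih =>
    have h : ∀ w : B, nested (fun _ : Fin (m + 1) => w) z = ⁅w, nested (fun _ : Fin m => w) z⁆ := by
      intro w; simp [nested]
    rw [h, h, ih, pow_succ']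
    simp only [Ring.lie_def, smul_mul_assoc, mul_smul_comm, smul_sub, smul_smul]
    ring_nf

theorem nested_smul_right {B : Type*} [Ring B] [Algebra ℂ B] (c : ℂ) {m : ℕ} (y z : B) :
    nested (fun _ : Fin m => y) (c • z) = c • nested (fun _ : Fin m => y) z := by
  induction m with
  | zero => simp [nested]
  | succ m ih =>
    have h : ∀ w : B, nested (fun _ : Fin (m + 1) => y) w = ⁅y, nested (fun _ : Fin m => y) w⁆ := by
      intro w; simp [nested]
    rw [h, h, ih]
    simp only [Ring.lie_def, smul_mul_assoc, mul_smul_comm, smul_sub]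

theorem evalGen_rel (a b : D.U) (h : Rel D (evalGen D Z) a b) : a = b := by
  cases h with
  | add a b =>
    have := toU_relator (Datum.Relator.add (D := D) a b)
    rw [toU_sub, toU_add, sub_eq_zero] at this
    exact this
  | smul c a =>
    have := toU_relator (Datum.Relator.smul (D := D) c a)
    rw [toU_sub, toU_smul, sub_eq_zero] at this
    rw [sc_smul_U]
    exact this
  | h_zero i => rfl
  | hh i j r s =>
    exact (toU_bracket _ _).symm.trans (toU_relator (Datum.Relator.comm (D := D) _ _))
  | h_cartan i r a =>
    exact (toU_bracket _ _).symm.trans (toU_relator (Datum.Relator.comm (D := D) _ _))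
  | cartan_cartan a b =>
    exact (toU_bracket _ _).symm.trans (toU_relator (Datum.Relator.comm (D := D) _ _))
  | cartan_x a ε j s =>
    have he := toU_relator (Datum.Relator.cartan_e (D := D) a j)
    have hf := toU_relator (Datum.Relator.cartan_f (D := D) a j)
    rw [toU_sub, toU_smul, toU_bracket, sub_eq_zero] at he
    rw [toU_add, toU_smul, toU_bracket, add_eq_zero_iff_eq_neg] at hf
    rw [sc_smul_U]
    rcases Int.units_eq_one_or ε with rfl | rfl
    · simp only [evalGen, Datum.ux, if_true, Ring.lie_def] at he ⊢
      simp only [mul_smul_comm, smul_mul_assoc, ← smul_sub, he]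
      rw [smul_comm, sg, Units.val_one, Int.cast_one, one_mul]
    · have h1 : ((-1 : ℤˣ) = 1) = False := eq_false (by decide)
      simp only [evalGen, Datum.ux, h1, if_false, Ring.lie_def] at hf ⊢
      simp only [mul_smul_comm, smul_mul_assoc, ← smul_sub, hf]
      rw [smul_neg, smul_comm, sg, Units.val_neg, Units.val_one, Int.cast_neg, Int.cast_one,
        neg_one_mul, neg_smul]
  | x_x i j r s =>
    have he := toU_relator (Datum.Relator.e_f (D := D) i j)
    rw [toU_sub, toU_bracket, sub_eq_zero] at he
    have h1 : ((-1 : ℤˣ) = 1) = False := eq_false (by decide)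
    simp only [evalGen, Datum.ux, h1, if_false, if_true, Ring.lie_def] at he ⊢
    simp only [mul_smul_comm, smul_mul_assoc]
    rw [smul_comm, ← smul_sub, ← smul_sub, he]
    split_ifs with hij
    · subst hij
      have hl := toU_relator (Datum.Relator.smul (D := D) (D.d i : ℂ) (D.coroot i))
      rw [toU_sub, toU_smul, sub_eq_zero] at hl
      rw [hl, smul_smul, ← Complex.ofReal_mul, Real.mul_self_sqrt (Nat.cast_nonneg _),
        Complex.ofReal_natCast]
    · rw [toU_zero, smul_zero, smul_zero]
  | h_x i j ε r s =>
    rw [hbar_smul_U]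
    exact sub_self _
  | xx i j ε r s =>
    rw [hbar_smul_U]
    exact sub_self _
  | serre i j hij ε r s =>
    refine Finset.sum_eq_zero fun π _ => ?_
    simp only [evalGen]
    unfold Datum.ux
    rw [nested_smul, nested_smul_right]
    split_ifs
    · rw [← toU_ad_pow, toU_relator (Datum.Relator.serre_e (D := D) i j hij)]; simp
    · rw [← toU_ad_pow, toU_relator (Datum.Relator.serre_f (D := D) i j hij)]; simp

variable (D Z) in
/-- The composite of `ħ ↦ 0` and evaluation at `t = 1`. -/
def eval : Alg D Z →+* D.U :=
  (Alg.lift (evalGen D Z) evalGen_rel : Alg D Z →ₐ[ℂ[X]] D.U).toRingHom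

end Eval

/-! ### Completions -/

section Completion

variable {A : Type*} [Ring A] (F : ℕ → Ideal A) [∀ n, (F n).IsTwoSided]

/-- The inverse limit `lim A / F n` along a descending sequence of two-sided ideals: families whose
members at any two levels `m ≤ n` have a common representative in `A`. -/
def Completion : Subring (∀ n, A ⧸ F n) where
  carrier := {x | ∀ m n, m ≤ n → ∃ a : A, Ideal.Quotient.mk (F n) a = x n ∧
    Ideal.Quotient.mk (F m) a = x m}
  mul_mem' := fun {x y} hx hy m n h => by
    obtain ⟨a, ha, ha'⟩ := hx m n h
    obtain ⟨b, hb, hb'⟩ := hy m n h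
    exact ⟨a * b, by simp [ha, hb], by simp [ha', hb']⟩
  one_mem' := fun m n _ => ⟨1, by simp, by simp⟩
  add_mem' := fun {x y} hx hy m n h => by
    obtain ⟨a, ha, ha'⟩ := hx m n h
    obtain ⟨b, hb, hb'⟩ := hy m n h
    exact ⟨a + b, by simp [ha, hb], by simp [ha', hb']⟩
  zero_mem' := fun m n _ => ⟨0, by simp, by simp⟩
  neg_mem' := fun {x} hx m n h => by
    obtain ⟨a, ha, ha'⟩ := hx m n h
    exact ⟨-a, by simp [ha], by simp [ha']⟩

/-- The canonical map `A → lim A / F n`. -/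
def Completion.of : A →+* Completion F where
  toFun a := ⟨fun n => Ideal.Quotient.mk (F n) a, fun _ _ _ => ⟨a, rfl, rfl⟩⟩
  map_one' := rfl
  map_mul' _ _ := rfl
  map_zero' := rfl
  map_add' _ _ := rfl

/-- The projection `lim A / F n → A / F n`. -/
def Completion.proj (n : ℕ) : Completion F →+* A ⧸ F n :=
  (Pi.evalRingHom _ n).comp (Completion F).subtype

variable {F} in
theorem Completion.ext {x y : Completion F}
    (h : ∀ n, Completion.proj F n x = Completion.proj F n y) : x = y :=
  Subtype.ext (funext h)

variable {F} in
/-- A homomorphism `f : A → lim B / G n` such that `F n` has trivial image in `B / G n` for all `n`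
induces the homomorphism `lim A / F n → lim B / G n` which is the inverse limit of the maps
`A / F n → B / G n`. -/
def Completion.lift {B : Type*} [Ring B] {G : ℕ → Ideal B} [∀ n, (G n).IsTwoSided]
    (f : A →+* Completion G) (hf : ∀ n, ∀ a ∈ F n, Completion.proj G n (f a) = 0) :
    Completion F →+* Completion G :=
  RingHom.codRestrict
    (RingHom.comp (RingHom.pi fun n =>
      (Ideal.Quotient.lift (F n) ((Completion.proj G n).comp f) (hf n)).comp
        (Pi.evalRingHom (fun n => A ⧸ F n) n)) (Completion F).subtype)
    (Completion G) (by
      intro x m n h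
      obtain ⟨a, ha, ha'⟩ := x.2 m n h
      obtain ⟨b, hb, hb'⟩ := (f a).2 m n h
      refine ⟨b, ?_, ?_⟩
      · change _ = Ideal.Quotient.lift (F n) ((Completion.proj G n).comp f) (hf n) (x.1 n)
        rw [hb, ← ha, Ideal.Quotient.lift_mk]
        rfl
      · change _ = Ideal.Quotient.lift (F m) ((Completion.proj G m).comp f) (hf m) (x.1 m)
        rw [hb', ← ha', Ideal.Quotient.lift_mk]
        rfl)

/-- If `A` is an `R`-algebra, then so is `lim A / F n`. -/
instance Completion.algebra {R : Type*} [CommRing R] [Algebra R A] : Algebra R (Completion F) :=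
  ((Completion.of F).comp (algebraMap R A)).toAlgebra' fun c x => by
    apply Completion.ext
    intro n
    exact Algebra.commutes (A := A ⧸ F n) c (Completion.proj F n x)

/-- The projections as homomorphisms of algebras. -/
def Completion.projₐ (R : Type*) [CommRing R] [Algebra R A] (n : ℕ) :
    Completion F →ₐ[R] A ⧸ F n :=
  { Completion.proj F n with commutes' := fun _ => rfl }

variable [Algebra ℂ[X] A]

variable {F} in
theorem mk_algebraMap_eq (hF : ∀ n, algebraMap ℂ[X] A X ^ n ∈ F n) {n : ℕ} {p q : ℂ[X]}
    (h : ∀ k < n, p.coeff k = q.coeff k) :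
    Ideal.Quotient.mk (F n) (algebraMap ℂ[X] A p) = Ideal.Quotient.mk (F n) (algebraMap ℂ[X] A q) := by
  rw [Ideal.Quotient.eq, ← map_sub]
  obtain ⟨r, hr⟩ : X ^ n ∣ p - q := by
    rw [Polynomial.X_pow_dvd_iff]
    intro k hk
    rw [coeff_sub, h k hk, sub_self]
  rw [hr, map_mul, map_pow]
  exact Ideal.IsTwoSided.mul_mem_of_left _ (hF n)

variable {F} in
/-- The homomorphism `ℂ⟦ħ⟧ → lim A / F n`, where `ħ ^ n ∈ F n`: the power series `f` acts on `A / F n` as any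
polynomial congruent to it modulo `ħ ^ n`. -/
def Completion.psMap (hF : ∀ n, algebraMap ℂ[X] A X ^ n ∈ F n) :
    PowerSeries ℂ →+* Completion F where
  toFun f := ⟨fun n => Ideal.Quotient.mk (F n) (algebraMap ℂ[X] A (PowerSeries.trunc n f)),
    fun m n h => ⟨algebraMap ℂ[X] A (PowerSeries.trunc n f), rfl, mk_algebraMap_eq hF fun k hk => by
      simp only [PowerSeries.coeff_trunc, hk, hk.trans_le h, if_true]⟩⟩
  map_one' := by
    apply Completion.ext
    intro n
    change Ideal.Quotient.mk (F n) (algebraMap ℂ[X] A (PowerSeries.trunc n 1)) = 1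
    rw [mk_algebraMap_eq hF (q := 1), map_one, map_one]
    intro k hk
    rw [PowerSeries.coeff_trunc, if_pos hk, PowerSeries.coeff_one, Polynomial.coeff_one]
  map_zero' := by
    apply Completion.ext
    intro n
    change Ideal.Quotient.mk (F n) (algebraMap ℂ[X] A (PowerSeries.trunc n 0)) = 0
    rw [map_zero, map_zero, map_zero]
  map_add' f g := by
    apply Completion.ext
    intro n
    change Ideal.Quotient.mk (F n) (algebraMap ℂ[X] A (PowerSeries.trunc n (f + g))) =
      Ideal.Quotient.mk (F n) (algebraMap ℂ[X] A (PowerSeries.trunc n f)) +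
      Ideal.Quotient.mk (F n) (algebraMap ℂ[X] A (PowerSeries.trunc n g))
    rw [map_add, map_add, map_add]
  map_mul' f g := by
    apply Completion.ext
    intro n
    change Ideal.Quotient.mk (F n) (algebraMap ℂ[X] A (PowerSeries.trunc n (f * g))) =
      Ideal.Quotient.mk (F n) (algebraMap ℂ[X] A (PowerSeries.trunc n f)) *
      Ideal.Quotient.mk (F n) (algebraMap ℂ[X] A (PowerSeries.trunc n g))
    rw [← map_mul, ← map_mul]
    apply mk_algebraMap_eq hF
    intro k hk
    rw [PowerSeries.coeff_trunc, if_pos hk, PowerSeries.coeff_mul_eq_coeff_trunc_mul_trunc f g hk,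
      ← Polynomial.coe_mul, Polynomial.coeff_coe]

variable {F} in
/-- The resulting structure of a `ℂ⟦ħ⟧`-algebra on `lim A / F n`. -/
@[reducible] def Completion.psAlgebra (hF : ∀ n, algebraMap ℂ[X] A X ^ n ∈ F n) :
    Algebra (PowerSeries ℂ) (Completion F) :=
  (Completion.psMap hF).toAlgebra' fun f x => by
    apply Completion.ext
    intro n
    exact Algebra.commutes (A := A ⧸ F n) (PowerSeries.trunc n f) (Completion.proj F n x)

end Completion

/-! ### The Yangian double -/

section Double

variable (D : Datum I 𝔥)

/-- The ideal generated by the central element `ħ` in the `ℂ[ħ]`-form of the double. -/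
def hbarIdeal : Ideal (DoubleForm D) := Ideal.span {algebraMap ℂ[X] (DoubleForm D) hbar}

instance : (hbarIdeal D).IsTwoSided where
  mul_mem_of_left b h := by
    obtain ⟨a, rfl⟩ := Ideal.mem_span_singleton'.1 h
    exact Ideal.mem_span_singleton'.2 ⟨a * b, by
      rw [mul_assoc, mul_assoc, Algebra.commutes hbar b]⟩

theorem exists_eq_of_mem_hbarIdeal_pow (n : ℕ) {x : DoubleForm D} (hx : x ∈ hbarIdeal D ^ n) :
    ∃ a, x = a * algebraMap ℂ[X] (DoubleForm D) (hbar ^ n) := by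
  induction n generalizing x with
  | zero => exact ⟨x, by simp⟩
  | succ n ih =>
    rw [Submodule.pow_succ] at hx
    induction hx using Submodule.mul_induction_on' with
    | mem_mul_mem y hy z hz =>
      obtain ⟨a, rfl⟩ := ih hy
      obtain ⟨b, rfl⟩ := Ideal.mem_span_singleton'.1 hz
      exact ⟨a * b, by
        rw [mul_assoc a, ← mul_assoc _ b, Algebra.commutes _ b, mul_assoc b, ← map_mul, pow_succ,
          mul_assoc]⟩
    | add y hy z hz h1 h2 =>
      obtain ⟨a, rfl⟩ := h1
      obtain ⟨b, rfl⟩ := h2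
      exact ⟨a + b, by rw [add_mul]⟩

/-- The Yangian double: the `ℂ⟦ħ⟧`-algebra topologically generated by the above generators subject
to the above relations, that is, the `ħ`-adic completion of the `ℂ[ħ]`-form. -/
def Double : Type _ := Completion fun n => hbarIdeal D ^ n

instance : Ring (Double D) := inferInstanceAs (Ring (Completion fun n => hbarIdeal D ^ n))

theorem hbar_mem_hbarIdeal : algebraMap ℂ[X] (DoubleForm D) X ∈ hbarIdeal D :=
  Ideal.subset_span rfl

instance : Algebra (PowerSeries ℂ) (Double D) :=
  Completion.psAlgebra (F := fun n => hbarIdeal D ^ n)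
    fun n => Ideal.pow_mem_pow (hbar_mem_hbarIdeal D) n

/-- The natural homomorphism from the `ℂ[ħ]`-form to the double. -/
def jmap : DoubleForm D →+* Double D := Completion.of fun n => hbarIdeal D ^ n

/-- The natural homomorphism `ι : Y_ħ 𝔤 → DY_ħ 𝔤`. -/
def iota : Yangian D →+* Double D := (jmap D).comp (iotaForm D).toRingHom

theorem eval_hbar (Z : Type*) [AddMonoidWithOne Z] :
    eval D Z (algebraMap ℂ[X] (Alg D Z) X) = 0 := by
  let := evalAlgebra D
  change Alg.lift (evalGen D Z) evalGen_rel (algebraMap ℂ[X] (Alg D Z) X) = 0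
  rw [AlgHom.commutes]
  change (algebraMap ℂ D.U) (Polynomial.evalRingHom 0 X) = 0
  simp

theorem eval_eq_zero_of_mem (x : DoubleForm D) (hx : x ∈ hbarIdeal D ^ 1) : eval D ℤ x = 0 := by
  obtain ⟨a, rfl⟩ := exists_eq_of_mem_hbarIdeal_pow D 1 hx
  rw [map_mul, pow_one, eval_hbar, mul_zero]

/-- The composite `DY_ħ 𝔤 → U(𝔤)` of reduction modulo `ħ` and evaluation at `t = 1`. -/
def evalDouble : Double D →+* D.U :=
  (Ideal.Quotient.lift (hbarIdeal D ^ 1) (eval D ℤ) (eval_eq_zero_of_mem D)).comp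
    (Completion.proj (fun n => hbarIdeal D ^ n) 1)

/-- The evaluation ideal `𝒥` of the double at `t = 1`. -/
def J : Ideal (Double D) := RingHom.ker (evalDouble D)

instance : (J D).IsTwoSided := inferInstanceAs (RingHom.ker _).IsTwoSided

/-- The evaluation ideal `𝒥₊` of the Yangian at `t = 1`. -/
def Jplus : Ideal (Yangian D) := RingHom.ker (eval D ℕ)

instance : (Jplus D).IsTwoSided := inferInstanceAs (RingHom.ker _).IsTwoSided

/-- The completion of the double along the powers of `𝒥`. -/
def CompletedDouble : Type _ := Completion fun n => J D ^ n

instance : Ring (CompletedDouble D) := inferInstanceAs (Ring (Completion fun n => J D ^ n))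

instance : Algebra (PowerSeries ℂ) (CompletedDouble D) :=
  inferInstanceAs (Algebra (PowerSeries ℂ) (Completion fun n => J D ^ n))

/-- The completion of the Yangian along the powers of `𝒥₊`. -/
def EvalCompletedYangian : Type _ := Completion fun n => Jplus D ^ n

instance : Ring (EvalCompletedYangian D) := inferInstanceAs (Ring (Completion fun n => Jplus D ^ n))

instance : Algebra (PowerSeries ℂ) (EvalCompletedYangian D) :=
  Completion.psAlgebra (F := fun n => Jplus D ^ n)
    fun n => Ideal.pow_mem_pow (RingHom.mem_ker.2 (eval_hbar D ℕ)) n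

end Double

/-! ### The grading completion of the Yangian -/

section Grading

variable (D : Datum I 𝔥)

/-- Degrees of the generators: `deg h = 0`, `deg x_{ir}^± = deg h_{ir} = r`. -/
def Gen.deg : Gen I 𝔥 ℕ → ℕ
  | .cartan _ => 0
  | .x _ _ r => r
  | .h _ r => r

/-- The graded component of degree `k`, with `deg ħ = 1`: the span of the monomials
`ħ^a y_1 ⋯ y_l` in generators of total degree `k`. -/
def gradedPiece (k : ℕ) : AddSubgroup (Yangian D) :=
  AddSubgroup.closure {y | ∃ (c : ℂ) (a : ℕ) (l : List (Gen I 𝔥 ℕ)),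
    a + (l.map Gen.deg).sum = k ∧ y = (sc c * hbar ^ a) • (l.map (Alg.gen D ℕ)).prod}

/-- The two-sided ideal `⨁_{k ≥ n} Y_k`. -/
def degGE (n : ℕ) : Ideal (Yangian D) :=
  (TwoSidedIdeal.span {y | ∃ k, n ≤ k ∧ y ∈ gradedPiece D k}).asIdeal

instance (n : ℕ) : (degGE D n).IsTwoSided := inferInstanceAs (TwoSidedIdeal.asIdeal _).IsTwoSided

/-- The completion `∏_k Y_k = lim Y / ⨁_{k ≥ n} Y_k` of the Yangian along its grading. -/
def CompletedYangian : Type _ := Completion (degGE D)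

instance : Ring (CompletedYangian D) := inferInstanceAs (Ring (Completion (degGE D)))

instance : Algebra ℂ[X] (CompletedYangian D) := Completion.algebra (degGE D)

theorem monomial_mem_degGE {n : ℕ} (c : ℂ) (a : ℕ) (l : List (Gen I 𝔥 ℕ))
    (h : n ≤ a + (l.map Gen.deg).sum) :
    (sc c * hbar ^ a) • (l.map (Alg.gen D ℕ)).prod ∈ degGE D n :=
  TwoSidedIdeal.mem_asIdeal.2 <| TwoSidedIdeal.subset_span
    ⟨_, h, AddSubgroup.subset_closure ⟨c, a, l, rfl, rfl⟩⟩

theorem hbar_pow_mem_degGE (n : ℕ) : algebraMap ℂ[X] (Yangian D) X ^ n ∈ degGE D n := by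
  have := monomial_mem_degGE D (n := n) 1 n [] (by simp)
  simpa [Algebra.smul_def] using this

theorem gen_mem_degGE {n : ℕ} (g : Gen I 𝔥 ℕ) (h : n ≤ g.deg) : Alg.gen D ℕ g ∈ degGE D n := by
  have := monomial_mem_degGE D (n := n) 1 0 [g] (by simpa using h)
  simpa using this

instance : Algebra (PowerSeries ℂ) (CompletedYangian D) :=
  Completion.psAlgebra (F := degGE D) (hbar_pow_mem_degGE D)

end Grading

/-! ### Shift automorphisms and their extension to the double -/

section Umbral

variable {B : Type*} [Ring B] [Algebra ℂ[X] B]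

/-- The linear map `t ^ n ↦ b n`. -/
def umbral (b : ℕ → B) : ℂ[X][X] →ₗ[ℂ[X]] B := (Polynomial.basisMonomials ℂ[X]).constr ℂ[X] b

theorem umbral_monomial (b : ℕ → B) (n : ℕ) (c : ℂ[X]) : umbral b (monomial n c) = c • b n := by
  have h : (monomial n c : ℂ[X][X]) = c • (Polynomial.basisMonomials ℂ[X] n) := by
    simp [smul_monomial]
  rw [h, map_smul, umbral, Module.Basis.constr_basis]

theorem umbral_X_mul (b : ℕ → B) (p : ℂ[X][X]) :
    umbral b (X * p) = umbral (fun n => b (n + 1)) p := by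
  induction p using Polynomial.induction_on' with
  | add p q hp hq => rw [mul_add, map_add, map_add, hp, hq]
  | monomial n c => rw [X_mul_monomial, umbral_monomial, umbral_monomial]

/-- The bilinear map `(p, q) ↦ [u p, v q]`. -/
def brLin (u v : ℂ[X][X] →ₗ[ℂ[X]] B) : ℂ[X][X] →ₗ[ℂ[X]] ℂ[X][X] →ₗ[ℂ[X]] B :=
  (LinearMap.mul ℂ[X] B).compl₁₂ u v - ((LinearMap.mul ℂ[X] B).compl₁₂ v u).flip

theorem brLin_apply (u v : ℂ[X][X] →ₗ[ℂ[X]] B) (p q : ℂ[X][X]) :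
    brLin u v p q = ⁅u p, v q⁆ := by
  simp [brLin, Ring.lie_def]

/-- The bilinear map `(p, q) ↦ u p * v q + v q * u p`. -/
def acLin (u v : ℂ[X][X] →ₗ[ℂ[X]] B) : ℂ[X][X] →ₗ[ℂ[X]] ℂ[X][X] →ₗ[ℂ[X]] B :=
  (LinearMap.mul ℂ[X] B).compl₁₂ u v + ((LinearMap.mul ℂ[X] B).compl₁₂ v u).flip

theorem acLin_apply (u v : ℂ[X][X] →ₗ[ℂ[X]] B) (p q : ℂ[X][X]) :
    acLin u v p q = u p * v q + v q * u p := by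
  simp [acLin]

theorem bilin_ext {f g : ℂ[X][X] →ₗ[ℂ[X]] ℂ[X][X] →ₗ[ℂ[X]] B}
    (h : ∀ m n, f (monomial m 1) (monomial n 1) = g (monomial m 1) (monomial n 1)) : f = g := by
  refine (Polynomial.basisMonomials ℂ[X]).ext fun m => (Polynomial.basisMonomials ℂ[X]).ext fun n => ?_
  simpa using h m n

theorem umbral_br (b b' : ℕ → B) (c : ℂ[X])
    (h : ∀ r s, ⁅b (r + 1), b' s⁆ - ⁅b r, b' (s + 1)⁆ = c • (b r * b' s + b' s * b r))
    (p q : ℂ[X][X]) :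
    ⁅umbral b (X * p), umbral b' q⁆ - ⁅umbral b p, umbral b' (X * q)⁆ =
      c • (umbral b p * umbral b' q + umbral b' q * umbral b p) := by
  have : brLin (umbral fun n => b (n + 1)) (umbral b') - brLin (umbral b) (umbral fun n => b' (n + 1)) =
      c • acLin (umbral b) (umbral b') := by
    refine bilin_ext fun m n => ?_
    simp only [LinearMap.sub_apply, LinearMap.smul_apply, brLin_apply, acLin_apply,
      umbral_monomial, one_smul]
    exact h m n
  have := LinearMap.congr_fun (LinearMap.congr_fun this p) q
  simpa only [LinearMap.sub_apply, LinearMap.smul_apply, brLin_apply, acLin_apply,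
    umbral_X_mul] using this

theorem umbral_br_zero (b b' : ℕ → B) (h : ∀ r s, ⁅b r, b' s⁆ = 0) (p q : ℂ[X][X]) :
    ⁅umbral b p, umbral b' q⁆ = 0 := by
  have : brLin (umbral b) (umbral b') = 0 := by
    refine bilin_ext fun m n => ?_
    simpa only [brLin_apply, umbral_monomial, one_smul, LinearMap.zero_apply] using h m n
  rw [← brLin_apply, this]; rfl

theorem umbral_br_mul (b b' b'' : ℕ → B) (h : ∀ r s, ⁅b r, b' s⁆ = b'' (r + s)) (p q : ℂ[X][X]) :
    ⁅umbral b p, umbral b' q⁆ = umbral b'' (p * q) := by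
  have : brLin (umbral b) (umbral b') = (LinearMap.mul ℂ[X] ℂ[X][X]).compr₂ (umbral b'') := by
    refine bilin_ext fun m n => ?_
    simpa only [brLin_apply, umbral_monomial, one_smul, LinearMap.compr₂_apply,
      LinearMap.mul_apply', monomial_mul_monomial, mul_one] using h m n
  rw [← brLin_apply, this]; rfl

theorem umbral_lie (a : B) (b : ℕ → B) (c : ℂ[X]) (h : ∀ s, ⁅a, b s⁆ = c • b s) (p : ℂ[X][X]) :
    ⁅a, umbral b p⁆ = c • umbral b p := by
  induction p using Polynomial.induction_on' with
  | add p q hp hq =>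
    rw [map_add, smul_add, ← hp, ← hq]; simp only [Ring.lie_def, mul_add, add_mul]; abel
  | monomial n d =>
    rw [umbral_monomial, smul_comm c, ← h n]
    simp only [Ring.lie_def, smul_sub, mul_smul_comm, smul_mul_assoc]

/-- `ad` as a linear map. -/
def adLin : B →ₗ[ℂ[X]] Module.End ℂ[X] B :=
  LinearMap.mul ℂ[X] B - (LinearMap.mul ℂ[X] B).flip

theorem nested_eq {m : ℕ} (y : Fin m → B) (z : B) :
    nested y z = (List.ofFn fun k => adLin (y k)).prod z := by
  have h : ∀ l : List B, l.foldr (fun a b => ⁅a, b⁆) z = ((l.map adLin).prod : Module.End ℂ[X] B) z := by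
    intro l
    induction l with
    | nil => simp
    | cons a l ih =>
      rw [List.foldr_cons, ih, List.map_cons, List.prod_cons, Module.End.mul_apply]
      simp [adLin, Ring.lie_def]
  rw [nested, h, List.map_ofFn]
  rfl

/-- The symmetrized nested commutator as a multilinear map. -/
def serreMul (m : ℕ) (u : ℂ[X][X] →ₗ[ℂ[X]] B) :
    MultilinearMap ℂ[X] (fun _ : Fin m => ℂ[X][X]) (Module.End ℂ[X] B) :=
  ∑ π : Equiv.Perm (Fin m),
    ((MultilinearMap.mkPiAlgebraFin ℂ[X] m (Module.End ℂ[X] B)).compLinearMap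
      fun _ => adLin ∘ₗ u).domDomCongr π

theorem serreMul_apply {m : ℕ} (u : ℂ[X][X] →ₗ[ℂ[X]] B) (p : Fin m → ℂ[X][X]) (z : B) :
    serreMul m u p z = ∑ π : Equiv.Perm (Fin m), nested (fun k => u (p (π k))) z := by
  simp [serreMul, nested_eq, LinearMap.sum_apply]

theorem umbral_serre {m : ℕ} (b b' : ℕ → B)
    (h : ∀ (r : Fin m → ℕ) (s : ℕ),
      ∑ π : Equiv.Perm (Fin m), nested (fun k => b (r (π k))) (b' s) = 0)
    (p : Fin m → ℂ[X][X]) (q : ℂ[X][X]) :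
    ∑ π : Equiv.Perm (Fin m), nested (fun k => umbral b (p (π k))) (umbral b' q) = 0 := by
  have h1 : ∀ s, (LinearMap.applyₗ (R := ℂ[X]) (b' s)).compMultilinearMap (serreMul m (umbral b)) = 0 := by
    intro s
    refine Module.Basis.ext_multilinear (fun _ => Polynomial.basisMonomials ℂ[X]) fun r => ?_
    simp only [LinearMap.compMultilinearMap_apply, LinearMap.applyₗ_apply_apply, serreMul_apply,
      coe_basisMonomials, umbral_monomial, one_smul, zero_apply]
    exact h r s
  have h2 : (serreMul m (umbral b) p) ∘ₗ umbral b' = 0 := by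
    refine (Polynomial.basisMonomials ℂ[X]).ext fun s => ?_
    have := congrArg (fun f => f p) (h1 s)
    simpa [umbral_monomial] using this
  have := LinearMap.congr_fun h2 q
  simpa [serreMul_apply] using this

/-- The family obtained from a family indexed by modes in `ℕ` on replacing `t ^ r` by `P r`. -/
def umbralGen (g : Gen I 𝔥 ℕ → B) (P : Z → ℂ[X][X]) : Gen I 𝔥 Z → B
  | .cartan a => g (.cartan a)
  | .x ε i r => umbral (fun n => g (.x ε i n)) (P r)
  | .h i r => umbral (fun n => g (.h i n)) (P r)

theorem umbralGen_rel (g : Gen I 𝔥 ℕ → B) (hg : ∀ a b, Rel D g a b → a = b)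
    (P : Z → ℂ[X][X]) (K : Ideal ℂ[X][X]) (c : ℂ[X])
    (hKx : ∀ ε i, ∀ p ∈ K, umbral (fun n => g (.x ε i n)) p = 0)
    (hKh : ∀ i, ∀ p ∈ K, umbral (fun n => g (.h i n)) p = 0)
    (h0 : P 0 - 1 ∈ K) (h1 : P 1 - (X + C c) ∈ K) (hadd : ∀ r s, P (r + s) - P r * P s ∈ K)
    (a b : B) (h : Rel D (umbralGen g P) a b) : a = b := by
  have hs : ∀ r, P (r + 1) - (X * P r + c • P r) ∈ K := fun r => by
    have e : P (r + 1) - (X * P r + c • P r) =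
        (P (r + 1) - P r * P 1) + P r * (P 1 - (X + C c)) := by
      rw [smul_eq_C_mul]; ring
    rw [e]
    exact K.add_mem (hadd r 1) (K.mul_mem_left _ h1)
  have hsx : ∀ ε i r, umbral (fun n => g (.x ε i n)) (P (r + 1)) =
      umbral (fun n => g (.x ε i n)) (X * P r) + c • umbral (fun n => g (.x ε i n)) (P r) :=
    fun ε i r => by
      have := hKx ε i _ (hs r)
      rwa [map_sub, map_add, map_smul, sub_eq_zero] at this
  have hsh : ∀ i r, umbral (fun n => g (.h i n)) (P (r + 1)) =
      umbral (fun n => g (.h i n)) (X * P r) + c • umbral (fun n => g (.h i n)) (P r) :=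
    fun i r => by
      have := hKh i _ (hs r)
      rwa [map_sub, map_add, map_smul, sub_eq_zero] at this
  have br : ∀ u u' v v' : B, ⁅u + c • u', v'⁆ - ⁅u', v + c • v'⁆ = ⁅u, v'⁆ - ⁅u', v⁆ := by
    intro u u' v v'
    simp only [Ring.lie_def, mul_add, add_mul, mul_smul_comm, smul_mul_assoc]
    abel
  cases h with
  | add a b => exact hg _ _ (.add a b)
  | smul c a => exact hg _ _ (.smul c a)
  | h_zero i =>
    have := hKh i _ h0
    rw [map_sub, sub_eq_zero] at this
    refine Eq.trans (this.trans ?_) (hg _ _ (.h_zero i))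
    rw [← monomial_zero_one, umbral_monomial, one_smul]
  | hh i j r s => exact umbral_br_zero _ _ (fun r s => hg _ _ (.hh i j r s)) _ _
  | h_cartan i r a =>
    have h' : ∀ s, ⁅g (.cartan a), g (.h i s)⁆ = (0 : ℂ[X]) • g (.h i s) := fun s => by
      have := hg _ _ (.h_cartan i s a)
      rw [zero_smul, Ring.lie_def, sub_eq_zero, eq_comm, ← sub_eq_zero, ← Ring.lie_def]
      exact this
    have := umbral_lie (g (.cartan a)) (fun n => g (.h i n)) 0 h' (P r)
    rw [zero_smul, Ring.lie_def, sub_eq_zero, eq_comm, ← sub_eq_zero] at this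
    exact this
  | cartan_cartan a b => exact hg _ _ (.cartan_cartan a b)
  | cartan_x a ε j s => exact umbral_lie _ _ _ (fun s => hg _ _ (.cartan_x a ε j s)) _
  | x_x i j r s =>
    by_cases hij : i = j
    · subst hij
      rw [if_pos rfl]
      refine (umbral_br_mul _ _ (fun n => g (.h i n))
        (fun r s => (hg _ _ (.x_x i i r s)).trans (if_pos rfl)) _ _).trans ?_
      have := hKh i _ (hadd r s)
      rw [map_sub, sub_eq_zero] at this
      exact this.symm
    · rw [if_neg hij]
      exact umbral_br_zero _ _ (fun r s => (hg _ _ (.x_x i j r s)).trans (if_neg hij)) _ _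
  | h_x i j ε r s =>
    simp only [umbralGen, hsx, hsh, br]
    exact umbral_br _ _ _ (fun r s => hg _ _ (.h_x i j ε r s)) _ _
  | xx i j ε r s =>
    simp only [umbralGen, hsx, br]
    exact umbral_br _ _ _ (fun r s => hg _ _ (.xx i j ε r s)) _ _
  | serre i j hij ε r s =>
    exact umbral_serre _ _ (fun r s => hg _ _ (.serre i j hij ε r s)) (fun k => P (r k)) (P s)

end Umbral

section Shift

variable (D : Datum I 𝔥)

theorem umbral_pow {B : Type*} [Ring B] [Algebra ℂ[X] B] (b : ℕ → B) (c : ℂ) (r : ℕ) :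
    umbral b ((X + C (sc c)) ^ r) =
      ∑ k ∈ Finset.range (r + 1), sc ((r.choose k : ℂ) * c ^ (r - k)) • b k := by
  rw [add_pow, map_sum]
  refine Finset.sum_congr rfl fun k _ => ?_
  have : (X ^ k * C (sc c) ^ (r - k) * (r.choose k : ℂ[X][X]) : ℂ[X][X]) =
      monomial k (sc ((r.choose k : ℂ) * c ^ (r - k))) := by
    rw [← C_mul_X_pow_eq_monomial]
    simp only [map_mul, map_pow, map_natCast]
    ring
  rw [this, umbral_monomial]

/-- `τ_c(h) = h`, `τ_c(x_{ir}) = ∑_{k ≤ r} (r choose k) c^{r-k} x_{ik}`, and similarly for `h_{ir}`. -/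
def shiftGen (c : ℂ) : Gen I 𝔥 ℕ → Yangian D
  | .cartan a => Alg.gen D ℕ (.cartan a)
  | .x ε i r => ∑ k ∈ Finset.range (r + 1),
      sc ((r.choose k : ℂ) * c ^ (r - k)) • Alg.gen D ℕ (.x ε i k)
  | .h i r => ∑ k ∈ Finset.range (r + 1),
      sc ((r.choose k : ℂ) * c ^ (r - k)) • Alg.gen D ℕ (.h i k)

theorem shiftGen_eq (c : ℂ) :
    shiftGen D c = umbralGen (Alg.gen D ℕ) fun r => (X + C (sc c)) ^ r := by
  funext g
  cases g with
  | cartan a => rfl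
  | x ε i r => exact (umbral_pow _ c r).symm
  | h i r => exact (umbral_pow _ c r).symm

theorem shiftGen_rel (c : ℂ) (a b : Yangian D) (h : Rel D (shiftGen D c) a b) : a = b := by
  rw [shiftGen_eq] at h
  refine umbralGen_rel (Alg.gen D ℕ) Alg.gen_rel _ ⊥ (sc c) ?_ ?_ ?_ ?_ ?_ a b h
  · rintro ε i p hp; rw [(Submodule.mem_bot _).1 hp, map_zero]
  · rintro i p hp; rw [(Submodule.mem_bot _).1 hp, map_zero]
  · simp
  · simp
  · intro r s; simp [pow_add]

/-- The shift homomorphism `τ_c`. -/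
def shift (c : ℂ) : Yangian D →ₐ[ℂ[X]] Yangian D := Alg.lift (shiftGen D c) (shiftGen_rel D c)

/-- The element `∑_n (r choose n) b_n` of the grading completion, where `b_n` has degree `≥ n`. -/
def binomSum (b : ℕ → Yangian D) (hb : ∀ m n, m ≤ n → b n ∈ degGE D m) (r : ℤ) :
    CompletedYangian D :=
  ⟨fun N => Ideal.Quotient.mk (degGE D N)
    (∑ n ∈ Finset.range N, sc ((Ring.choose r n : ℤ) : ℂ) • b n), fun M N h =>
    ⟨∑ n ∈ Finset.range N, sc ((Ring.choose r n : ℤ) : ℂ) • b n, rfl, by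
      rw [Ideal.Quotient.eq, ← Finset.sum_sdiff (Finset.range_subset_range.2 h), add_sub_cancel_right]
      refine Ideal.sum_mem _ fun n hn => ?_
      rw [Finset.mem_sdiff, Finset.mem_range, Finset.mem_range, not_lt] at hn
      rw [Algebra.smul_def]
      exact Ideal.mul_mem_left _ _ (hb M n hn.2)⟩⟩

/-- The values of `Φ` on generators: `Φ(h) = h` and
`Φ(𝒳_i^±(u)) = ∑_n (-1)^n x_{in}^± ∂_u^n(δ(u)) / n!`, that is,
`Φ(𝒳_{ir}^±) = ∑_n (r choose n) x_{in}^±` for `r ∈ ℤ`, and similarly for `ℋ_{ir}`. -/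
def phiGen : Gen I 𝔥 ℤ → CompletedYangian D
  | .cartan a => Completion.of (degGE D) (Alg.gen D ℕ (.cartan a))
  | .x ε i r => binomSum D (fun n => Alg.gen D ℕ (.x ε i n)) (fun _ _ h => gen_mem_degGE D _ h) r
  | .h i r => binomSum D (fun n => Alg.gen D ℕ (.h i n)) (fun _ _ h => gen_mem_degGE D _ h) r

/-- The projection of the grading completion to `Y / ⨁_{k ≥ N} Y_k`. -/
def CompletedYangian.proj (N : ℕ) : CompletedYangian D →ₐ[ℂ[X]] Yangian D ⧸ degGE D N :=
  Completion.projₐ (degGE D) ℂ[X] N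

/-- Truncation of the power series `(1 + t) ^ r`. -/
def truncBinom (N : ℕ) (r : ℤ) : ℂ[X][X] :=
  PowerSeries.trunc N (PowerSeries.binomialSeries ℂ[X] r)

theorem umbral_truncBinom {B : Type*} [Ring B] [Algebra ℂ[X] B] (b : ℕ → B) (N : ℕ) (r : ℤ) :
    umbral b (truncBinom N r) =
      ∑ n ∈ Finset.range N, sc ((Ring.choose r n : ℤ) : ℂ) • b n := by
  have e : truncBinom N r = ∑ n ∈ Finset.range N,
      monomial n (PowerSeries.coeff n (PowerSeries.binomialSeries ℂ[X] r)) := by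
    ext1 k
    simp [truncBinom, PowerSeries.coeff_trunc, coeff_monomial]
  rw [e, map_sum]
  refine Finset.sum_congr rfl fun n _ => ?_
  rw [umbral_monomial, PowerSeries.binomialSeries_coeff]
  simp

theorem phiGen_proj (N : ℕ) : (fun k => CompletedYangian.proj D N (phiGen D k)) =
    umbralGen (fun k => Ideal.Quotient.mk (degGE D N) (Alg.gen D ℕ k)) (truncBinom N) := by
  have h : ∀ b : ℕ → Yangian D, ∀ r : ℤ, Ideal.Quotient.mk (degGE D N)
      (∑ n ∈ Finset.range N, sc ((Ring.choose r n : ℤ) : ℂ) • b n) =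
      umbral (fun n => Ideal.Quotient.mk (degGE D N) (b n)) (truncBinom N r) := by
    intro b r
    rw [umbral_truncBinom, map_sum]
    rfl
  funext k
  cases k with
  | cartan a => rfl
  | x ε i r => exact h _ r
  | h i r => exact h _ r

theorem umbral_X_pow_mul {B : Type*} [Ring B] [Algebra ℂ[X] B] (b : ℕ → B) (N : ℕ)
    (hb : ∀ n, N ≤ n → b n = 0) (p : ℂ[X][X]) (hp : p ∈ Ideal.span {(X : ℂ[X][X]) ^ N}) :
    umbral b p = 0 := by
  obtain ⟨q, rfl⟩ := Ideal.mem_span_singleton'.1 hp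
  induction q using Polynomial.induction_on' with
  | add q r hq hr =>
    rw [add_mul, map_add, hq (Ideal.mul_mem_left _ _ (Ideal.subset_span rfl)),
      hr (Ideal.mul_mem_left _ _ (Ideal.subset_span rfl)), add_zero]
  | monomial n c =>
    rw [monomial_mul_X_pow, umbral_monomial, hb _ (Nat.le_add_left _ _), smul_zero]

theorem mem_span_X_pow {N : ℕ} {p q : ℂ[X][X]} (h : ∀ k < N, p.coeff k = q.coeff k) :
    p - q ∈ Ideal.span {(X : ℂ[X][X]) ^ N} := by
  rw [Ideal.mem_span_singleton, Polynomial.X_pow_dvd_iff]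
  intro k hk
  rw [coeff_sub, h k hk, sub_self]

theorem phiGen_rel (a b : CompletedYangian D) (h : Rel D (phiGen D) a b) : a = b := by
  refine Completion.ext fun N => ?_
  change CompletedYangian.proj D N a = CompletedYangian.proj D N b
  have h' := h.map (CompletedYangian.proj D N)
  rw [phiGen_proj] at h'
  have hz : ∀ g : Gen I 𝔥 ℕ, N ≤ g.deg → Ideal.Quotient.mk (degGE D N) (Alg.gen D ℕ g) = 0 :=
    fun g hg => Ideal.Quotient.eq_zero_iff_mem.2 (gen_mem_degGE D g hg)
  refine umbralGen_rel (fun k => Ideal.Quotient.mk (degGE D N) (Alg.gen D ℕ k)) ?_ (truncBinom N)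
    (Ideal.span {X ^ N}) 1 ?_ ?_ ?_ ?_ ?_ _ _ h'
  · intro a b hab
    obtain ⟨a', b', h1, rfl, rfl⟩ := Rel.exists_lift (D := D) (g := Alg.gen D ℕ)
      (Ideal.Quotient.mkₐ ℂ[X] (degGE D N)) hab
    rw [Alg.gen_rel _ _ h1]
  · exact fun ε i p hp => umbral_X_pow_mul _ N (fun n hn => hz (.x ε i n) hn) p hp
  · exact fun i p hp => umbral_X_pow_mul _ N (fun n hn => hz (.h i n) hn) p hp
  · refine mem_span_X_pow fun k hk => ?_
    rw [truncBinom, PowerSeries.coeff_trunc, if_pos hk, PowerSeries.binomialSeries_zero,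
      PowerSeries.coeff_one, Polynomial.coeff_one]
  · refine mem_span_X_pow fun k hk => ?_
    have e : PowerSeries.binomialSeries ℂ[X] (1 : ℤ) = ((1 + X : ℂ[X][X]) : PowerSeries ℂ[X]) := by
      have := PowerSeries.binomialSeries_nat (R := ℤ) (A := ℂ[X]) 1
      simpa using this
    rw [truncBinom, PowerSeries.coeff_trunc, if_pos hk, e, Polynomial.coeff_coe, map_one, add_comm]
  · intro r s
    refine mem_span_X_pow fun k hk => ?_
    rw [truncBinom, PowerSeries.coeff_trunc, if_pos hk, PowerSeries.binomialSeries_add,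
      PowerSeries.coeff_mul_eq_coeff_trunc_mul_trunc _ _ hk, ← Polynomial.coe_mul,
      Polynomial.coeff_coe]
    rfl

/-- `Φ` on the `ℂ[ħ]`-form of the double. -/
def phiForm : DoubleForm D →ₐ[ℂ[X]] CompletedYangian D := Alg.lift (phiGen D) (phiGen_rel D)

theorem proj_phiForm_eq_zero (n : ℕ) (a : DoubleForm D) (ha : a ∈ hbarIdeal D ^ n) :
    Completion.proj (degGE D) n (phiForm D a) = 0 := by
  obtain ⟨b, rfl⟩ := exists_eq_of_mem_hbarIdeal_pow D n ha
  rw [map_mul, AlgHom.commutes]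
  change CompletedYangian.proj D n (_ * _) = 0
  rw [map_mul, AlgHom.commutes]
  have : algebraMap ℂ[X] (Yangian D ⧸ degGE D n) (hbar ^ n) =
      Ideal.Quotient.mk (degGE D n) (algebraMap ℂ[X] (Yangian D) X ^ n) := by
    rw [← map_pow]; rfl
  rw [this, Ideal.Quotient.eq_zero_iff_mem.2 (hbar_pow_mem_degGE D n), mul_zero]

/-- The homomorphism `Φ = Φ_1` from the double to the grading completion of the Yangian. -/
def Phi : Double D →ₐ[PowerSeries ℂ] CompletedYangian D :=
  { Completion.lift (F := fun n => hbarIdeal D ^ n) (G := degGE D) (phiForm D).toRingHom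
      (proj_phiForm_eq_zero D) with
    commutes' := fun f => by
      refine Completion.ext fun n => ?_
      change CompletedYangian.proj D n (phiForm D (algebraMap ℂ[X] _ (PowerSeries.trunc n f))) = _
      rw [AlgHom.commutes, AlgHom.commutes]
      rfl }

end Shift

/-! ### The induced maps of completions -/

section Maps

variable (D : Datum I 𝔥)

/-- `ι(𝒥₊^n) ⊆ 𝒥^n` for all `n`. -/
def IotaFiltered : Prop := ∀ n, ∀ y ∈ Jplus D ^ n, iota D y ∈ J D ^ n

/-- `τ_{-1}(⨁_{k ≥ n} Y_k) ⊆ 𝒥₊^n` for all `n`. -/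
def ShiftFiltered : Prop := ∀ n, ∀ y ∈ degGE D n, shift D (-1) y ∈ Jplus D ^ n

/-- `Φ(𝒥^n) ⊆ ∏_{k ≥ n} Y_k` for all `n`. -/
def PhiFiltered : Prop := ∀ n, ∀ x ∈ J D ^ n, CompletedYangian.proj D n (Phi D x) = 0

variable {D}

/-- The map of completions induced by `ι`. -/
def iotaHat (h : IotaFiltered D) : EvalCompletedYangian D →+* CompletedDouble D :=
  Completion.lift (F := fun n => Jplus D ^ n) ((Completion.of fun n => J D ^ n).comp (iota D))
    fun n a ha => Ideal.Quotient.eq_zero_iff_mem.2 (h n a ha)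

/-- The map `Γ̂` of completions induced by `τ_{-1}`. -/
def gammaHat (h : ShiftFiltered D) : CompletedYangian D →+* EvalCompletedYangian D :=
  Completion.lift (F := degGE D)
    ((Completion.of fun n => Jplus D ^ n).comp (shift D (-1)).toRingHom)
    fun n a ha => Ideal.Quotient.eq_zero_iff_mem.2 (h n a ha)

/-- The map `Φ̂` of completions induced by `Φ`. -/
def phiHat (h : PhiFiltered D) : CompletedDouble D →+* CompletedYangian D :=
  Completion.lift (F := fun n => J D ^ n) (G := degGE D) (Phi D).toRingHom h

end Maps

end

end KacMoodyYangian

/-!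
The two completions are compared through `ι`, `τ_{-1}` and `Φ`, and the theorem rests on two facts.

*Differences lie in powers of the evaluation ideal.* The relation
`[h_{i1} - h_{i0}, x_s] = ± 2 d_i (x_{s+1} - x_s) ± ħ d_i (h_{i0} x_s + x_s h_{i0})`, `x_s = x_{is}^±`,
in which `h_{i1} - h_{i0}` and `ħ` lie in the evaluation ideal and `2 d_i` is invertible, shows by
induction that the `k`-th difference of the sequence `s ↦ x_{is}^±` lies in the `k`-th power of that
ideal; the same follows for `h_{is} = [x_{is}^+, x_{i0}^-]` (`fwdDiff_iter_x_mem`,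
`fwdDiff_iter_h_mem`). Since `τ_{-1}` sends `x_{ir}` to the `r`-th difference at `0`, it maps degree
`≥ n` into `𝒥₊ ^ n` (`shiftFiltered`). In the double, where the modes run through `ℤ`, Newton's
interpolation formula `eq_sum_choose_fwdDiff` shows that modulo `𝒥 ^ n` the mode `𝒳_{ir}` is the
finite sum of the terms `(r choose k) ι(τ_{-1}(x_{ik}))` with `k < n`, which is the image of
`Φ(𝒳_{ir})` (`iotaShift_phiForm`).

*In degree zero `Φ` is evaluation.* The elements `h, x_{i0}^±` of the Yangian satisfy the
Chevalley-Serre relations, so they define a map from `U(𝔤)` to the Yangian (`exists_section`).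
Modulo degree `≥ 1`, `Φ` is evaluation at `t = 1` followed by this map; hence `Φ(𝒥)` has degree `≥ 1`
and `Φ(𝒥 ^ n)` has degree `≥ n` (`phiFiltered`).

As `Φ ∘ ι = τ_1` (`Phi_iota`), `τ_1` maps `𝒥₊ ^ n` into degree `≥ n` and induces the inverse of `Γ̂`,
and `Γ̂ ∘ Φ̂ ∘ ι̂` is induced by `τ_{-1} ∘ τ_1 = id`. For the other composite, Newton's formula
settles the elements of the `ℂ[ħ]`-form; every element of the double differs from such an element by
a multiple of `ħ ^ n`, which lies in `𝒥 ^ n` (`mem_J_pow_of_proj_eq_zero`).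
-/

namespace KacMoodyYangian

open Polynomial

noncomputable section

variable {I 𝔥 : Type*} [Fintype I] [DecidableEq I] [AddCommGroup 𝔥] [Module ℂ 𝔥]

/-! ### Induction on generators -/

section Generators

variable {D : Datum I 𝔥} {Z : Type*} [AddMonoidWithOne Z]

theorem Alg.induction {P : Alg D Z → Prop} (hs : ∀ p, P (algebraMap ℂ[X] (Alg D Z) p))
    (hg : ∀ k, P (Alg.gen D Z k)) (hadd : ∀ a b, P a → P b → P (a + b))
    (hmul : ∀ a b, P a → P b → P (a * b)) (a : Alg D Z) : P a := by
  let φ : FreeAlgebra ℂ[X] (Gen I 𝔥 Z) →ₐ[ℂ[X]] Alg D Z :=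
    RingQuot.mkAlgHom ℂ[X] (Rel D (FreeAlgebra.ι ℂ[X] : Gen I 𝔥 Z → _))
  obtain ⟨b, rfl⟩ : ∃ b, φ b = a := RingQuot.mkAlgHom_surjective ℂ[X] _ a
  induction b using FreeAlgebra.induction with
  | grade0 r => rw [AlgHom.commutes]; exact hs r
  | grade1 k => exact hg k
  | mul a b ha hb => rw [map_mul]; exact hmul _ _ ha hb
  | add a b ha hb => rw [map_add]; exact hadd _ _ ha hb

theorem Alg.ringHom_ext {B : Type*} [Ring B] {f g : Alg D Z →+* B}
    (hs : ∀ p, f (algebraMap ℂ[X] (Alg D Z) p) = g (algebraMap ℂ[X] (Alg D Z) p))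
    (hg : ∀ k, f (Alg.gen D Z k) = g (Alg.gen D Z k)) (a : Alg D Z) : f a = g a := by
  induction a using Alg.induction with
  | hs p => exact hs p
  | hg k => exact hg k
  | hadd a b ha hb => rw [map_add, map_add, ha, hb]
  | hmul a b ha hb => rw [map_mul, map_mul, ha, hb]

theorem eval_gen (k : Gen I 𝔥 Z) : eval D Z (Alg.gen D Z k) = evalGen D Z k := by
  let := evalAlgebra D
  exact Alg.lift_gen _ _ k

theorem eval_algebraMap (p : ℂ[X]) :
    eval D Z (algebraMap ℂ[X] (Alg D Z) p) = algebraMap ℂ D.U (p.eval 0) := by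
  let := evalAlgebra D
  change Alg.lift (evalGen D Z) evalGen_rel (algebraMap ℂ[X] (Alg D Z) p) = _
  rw [AlgHom.commutes]
  rfl

end Generators

/-! ### Finite differences of currents -/

section Differences

/-- If `[T, b s] = c (b (s + h) - b s) + z (w (b s) + (b s) w)` with `T, z` in a two-sided ideal
and `c` invertible, then each commutator with `T` gains a power of the ideal, so the `k`-th
differences of `b` lie in its `k`-th power. -/
theorem fwdDiff_iter_mem_pow {A M : Type*} [Ring A] [AddCommMonoid M] (J : Ideal A) [J.IsTwoSided]
    {T z w c c' : A} (hT : T ∈ J) (hz : z ∈ J) (hc : c' * c = 1) (h : M) (b : M → A)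
    (hb : ∀ s, T * b s - b s * T = c * (b (s + h) - b s) + z * (w * b s + b s * w))
    (k : ℕ) (s : M) : ((fwdDiff h)^[k] b) s ∈ J ^ k := by
  have rel : ∀ k s, T * ((fwdDiff h)^[k] b) s - ((fwdDiff h)^[k] b) s * T =
      c * ((fwdDiff h)^[k + 1] b) s + z * (w * ((fwdDiff h)^[k] b) s + ((fwdDiff h)^[k] b) s * w) := by
    intro k
    induction k with
    | zero => exact hb
    | succ k ih =>
      intro s
      have e : ∀ m s, ((fwdDiff h)^[m + 1] b) s = ((fwdDiff h)^[m] b) (s + h) - ((fwdDiff h)^[m] b) s :=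
        fun m s => by rw [Function.iterate_succ_apply']; rfl
      rw [e (k + 1)]
      simp only [e k] at ih ⊢
      have h1 := ih (s + h)
      have h2 := ih s
      linear_combination (norm := noncomm_ring) h1 - h2
  induction k generalizing s with
  | zero => rw [Submodule.pow_zero, Ideal.one_eq_top]; trivial
  | succ k ih =>
    have hy := ih s
    have e : ((fwdDiff h)^[k + 1] b) s = c' * (T * ((fwdDiff h)^[k] b) s - ((fwdDiff h)^[k] b) s * T -
        z * (w * ((fwdDiff h)^[k] b) s + ((fwdDiff h)^[k] b) s * w)) := by
      rw [rel, add_sub_cancel_right, ← mul_assoc, hc, one_mul]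
    rw [e]
    have left : ∀ {u v}, u ∈ J → v ∈ J ^ k → u * v ∈ J ^ (k + 1) := fun hu hv => by
      rw [Ideal.IsTwoSided.pow_succ]
      exact Ideal.mul_mem_mul hu hv
    refine Ideal.mul_mem_left _ _ (sub_mem (sub_mem (left hT hy) ?_) (left hz ?_))
    · rw [Submodule.pow_succ]
      exact Ideal.mul_mem_mul hy hT
    · exact add_mem (Ideal.mul_mem_left _ _ hy) (Ideal.IsTwoSided.mul_mem_of_left _ hy)

theorem fwdDiff_iter_map {A B M : Type*} [AddCommGroup A] [AddCommGroup B] [AddCommMonoid M]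
    (f : A →+ B) (h : M) (b : M → A) (k : ℕ) (s : M) :
    ((fwdDiff h)^[k] fun m => f (b m)) s = f (((fwdDiff h)^[k] b) s) := by
  rw [fwdDiff_iter_eq_sum_shift, fwdDiff_iter_eq_sum_shift, map_sum]
  exact Finset.sum_congr rfl fun _ _ => (map_zsmul f _ _).symm

/-- Newton's interpolation formula at negative integers as well, for a sequence whose differences
of order `n` vanish. -/
theorem eq_sum_choose_fwdDiff {A : Type*} [AddCommGroup A] (n : ℕ) (b : ℤ → A)
    (hb : ∀ s, ((fwdDiff (1 : ℤ))^[n] b) s = 0) (r : ℤ) :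
    b r = ∑ k ∈ Finset.range n, Ring.choose r k • ((fwdDiff (1 : ℤ))^[k] b) 0 := by
  induction n generalizing b r with
  | zero => simpa using hb r
  | succ n ih =>
    have h1 := ih (fwdDiff (1 : ℤ) b) hb
    set E : ℤ → A := fun r => ∑ k ∈ Finset.range (n + 1), Ring.choose r k • ((fwdDiff (1 : ℤ))^[k] b) 0
      with hE
    have hstep : ∀ r, b (r + 1) - b r = E (r + 1) - E r := fun r => by
      rw [hE]
      simp only
      rw [Finset.sum_range_succ', Finset.sum_range_succ']
      simp only [Ring.choose_zero_right, add_sub_add_right_eq_sub, ← Finset.sum_sub_distrib,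
        ← sub_smul, Ring.choose_succ_succ, add_sub_cancel_right]
      exact h1 r
    have h0 : b 0 = E 0 := by
      rw [hE]
      simp only
      rw [Finset.sum_range_succ']
      simp [Ring.choose_zero_succ]
    induction r using Int.induction_on with
    | zero => exact h0
    | succ i hi =>
      have := hstep i
      rwa [hi, sub_left_inj] at this
    | pred i hi =>
      have := hstep (-i - 1)
      rw [sub_add_cancel] at this
      rwa [hi, sub_right_inj] at this

variable {D : Datum I 𝔥} {Z : Type*} [AddCommMonoidWithOne Z]

theorem Alg.h_one_bracket_x (i : I) (ε : ℤˣ) (s : Z) :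
    ⁅Alg.gen D Z (.h i 1) - Alg.gen D Z (.h i 0), Alg.gen D Z (.x ε i s)⁆ =
      algebraMap ℂ[X] (Alg D Z) (sc (sg ε * (2 * D.d i))) *
        (Alg.gen D Z (.x ε i (s + 1)) - Alg.gen D Z (.x ε i s)) +
      algebraMap ℂ[X] (Alg D Z) (hbar * sc (sg ε * D.dd i i)) *
        (Alg.gen D Z (.h i 0) * Alg.gen D Z (.x ε i s) +
          Alg.gen D Z (.x ε i s) * Alg.gen D Z (.h i 0)) := by
  have h1 := Alg.gen_rel _ _ (Rel.h_x (D := D) (g := Alg.gen D Z) i i ε 0 s)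
  have h0 := Alg.gen_rel _ _ (Rel.h_zero (D := D) (g := Alg.gen D Z) i)
  have hc : ∀ s, ⁅Alg.gen D Z (.h i 0), Alg.gen D Z (.x ε i s)⁆ =
      sc (sg ε * (2 * D.d i)) • Alg.gen D Z (.x ε i s) := fun s => by
    have := Alg.gen_rel _ _
      (Rel.cartan_x (D := D) (g := Alg.gen D Z) ((D.d i : ℂ) • D.coroot i) ε i s)
    rw [← h0, map_smul, D.root_coroot, D.diag] at this
    rw [this, smul_eq_mul, mul_comm (D.d i : ℂ)]
    norm_num
  rw [zero_add, hc (s + 1), sub_eq_iff_eq_add] at h1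
  have hs := hc s
  rw [Ring.lie_def] at h1 hs ⊢
  rw [Algebra.smul_def] at h1 hs
  rw [Algebra.smul_def] at h1
  linear_combination (norm := noncomm_ring) h1 - hs

theorem fwdDiff_iter_x_mem {A : Type*} [Ring A] (J : Ideal A) [J.IsTwoSided] (f : Alg D Z →+* A)
    (hX : f (algebraMap ℂ[X] (Alg D Z) hbar) ∈ J)
    (hJ : ∀ i, f (Alg.gen D Z (.h i 1)) - f (Alg.gen D Z (.h i 0)) ∈ J)
    (ε : ℤˣ) (i : I) (k : ℕ) (s : Z) :
    ((fwdDiff (1 : Z))^[k] fun r => f (Alg.gen D Z (.x ε i r))) s ∈ J ^ k := by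
  refine fwdDiff_iter_mem_pow J (hJ i)
    (z := f (algebraMap ℂ[X] (Alg D Z) (hbar * sc (sg ε * D.dd i i))))
    (c := f (algebraMap ℂ[X] (Alg D Z) (sc (sg ε * (2 * D.d i)))))
    (c' := f (algebraMap ℂ[X] (Alg D Z) (sc (sg ε * (2 * D.d i))⁻¹)))
    (w := f (Alg.gen D Z (.h i 0))) ?_ ?_ 1 _ (fun s => ?_) k s
  · rw [map_mul, map_mul]
    exact Ideal.IsTwoSided.mul_mem_of_left _ hX
  · have hd : (D.d i : ℂ) ≠ 0 := Nat.cast_ne_zero.2 (D.d_pos i).ne'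
    have hε : sg ε ≠ 0 := by rcases Int.units_eq_one_or ε with rfl | rfl <;> simp [sg]
    rw [← map_mul, ← map_mul, ← C_mul,
      inv_mul_cancel₀ (mul_ne_zero hε (mul_ne_zero two_ne_zero hd)), C_1, map_one, map_one]
  · have := congrArg f (Alg.h_one_bracket_x (D := D) i ε s)
    simpa only [Ring.lie_def, map_sub, map_mul, map_add] using this

theorem fwdDiff_iter_h_mem {A : Type*} [Ring A] (J : Ideal A) [J.IsTwoSided] (f : Alg D Z →+* A)
    (hX : f (algebraMap ℂ[X] (Alg D Z) hbar) ∈ J)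
    (hJ : ∀ i, f (Alg.gen D Z (.h i 1)) - f (Alg.gen D Z (.h i 0)) ∈ J)
    (i : I) (k : ℕ) (s : Z) :
    ((fwdDiff (1 : Z))^[k] fun r => f (Alg.gen D Z (.h i r))) s ∈ J ^ k := by
  set y := f (Alg.gen D Z (.x (-1) i 0))
  have e : (fun r => f (Alg.gen D Z (.h i r))) = fun r =>
      (AddMonoidHom.mulRight y - AddMonoidHom.mulLeft y) (f (Alg.gen D Z (.x 1 i r))) := by
    funext r
    have := Alg.gen_rel _ _ (Rel.x_x (D := D) (g := Alg.gen D Z) i i r 0)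
    rw [if_pos rfl, add_zero, Ring.lie_def] at this
    rw [← this, map_sub, map_mul, map_mul]
    rfl
  rw [e, fwdDiff_iter_map]
  have := fwdDiff_iter_x_mem J f hX hJ 1 i k s
  exact sub_mem (Ideal.IsTwoSided.mul_mem_of_left _ this) (Ideal.mul_mem_left _ _ this)

end Differences

/-! ### Compatibility with the filtrations -/

section Filtrations

variable (D : Datum I 𝔥)

theorem map_mem_of_mem_pow {A B : Type*} [Ring A] [Ring B] (J : Ideal A) (G : ℕ → Ideal B)
    (f : A →+* B) (h0 : G 0 = ⊤) (hmul : ∀ n, ∀ x ∈ G n, ∀ y ∈ G 1, x * y ∈ G (n + 1))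
    (hf : ∀ a ∈ J, f a ∈ G 1) (n : ℕ) (a : A) (ha : a ∈ J ^ n) : f a ∈ G n := by
  induction n generalizing a with
  | zero => rw [h0]; trivial
  | succ n ih =>
    rw [Submodule.pow_succ] at ha
    induction ha using Submodule.mul_induction_on' with
    | mem_mul_mem y hy z hz => rw [map_mul]; exact hmul n _ (ih y hy) _ (hf z hz)
    | add y _ z _ h1 h2 => rw [map_add]; exact add_mem h1 h2

theorem evalDouble_jmap (a : DoubleForm D) : evalDouble D (jmap D a) = eval D ℤ a := rfl

theorem iotaForm_gen (k : Gen I 𝔥 ℕ) :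
    iotaForm D (Alg.gen D ℕ k) = Alg.gen D ℤ (castGen k) := Alg.lift_gen _ _ k

theorem eval_iotaForm (y : Yangian D) : eval D ℤ (iotaForm D y) = eval D ℕ y := by
  refine Alg.ringHom_ext (f := (eval D ℤ).comp (iotaForm D).toRingHom) (fun p => ?_)
    (fun k => ?_) y
  · change eval D ℤ (iotaForm D (algebraMap ℂ[X] _ p)) = _
    rw [AlgHom.commutes, eval_algebraMap, eval_algebraMap]
  · change eval D ℤ (iotaForm D (Alg.gen D ℕ k)) = _
    rw [iotaForm_gen, eval_gen, eval_gen]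
    cases k <;> rfl

theorem iotaFiltered : IotaFiltered D := by
  refine map_mem_of_mem_pow (Jplus D) (fun n => J D ^ n) (iota D) ?_ ?_ ?_
  · rw [Submodule.pow_zero, Ideal.one_eq_top]
  · intro n x hx y hy
    rw [Submodule.pow_one] at hy
    rw [Submodule.pow_succ]
    exact Ideal.mul_mem_mul hx hy
  · intro y hy
    rw [Submodule.pow_one]
    exact RingHom.mem_ker.2 <|
      (evalDouble_jmap D _).trans ((eval_iotaForm D y).trans (RingHom.mem_ker.1 hy))

theorem hbar_mem_Jplus : algebraMap ℂ[X] (Yangian D) hbar ∈ Jplus D := eval_hbar D ℕ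

theorem hbar_mem_J : jmap D (algebraMap ℂ[X] (DoubleForm D) hbar) ∈ J D := eval_hbar D ℤ

theorem h_one_sub_h_zero_mem_Jplus (i : I) :
    Alg.gen D ℕ (.h i 1) - Alg.gen D ℕ (.h i 0) ∈ Jplus D := by
  refine RingHom.mem_ker.2 ?_
  rw [map_sub, eval_gen, eval_gen]
  exact sub_self _

theorem h_one_sub_h_zero_mem_J (i : I) :
    jmap D (Alg.gen D ℤ (.h i 1)) - jmap D (Alg.gen D ℤ (.h i 0)) ∈ J D := by
  refine RingHom.mem_ker.2 ?_
  rw [map_sub, evalDouble_jmap, evalDouble_jmap, eval_gen, eval_gen]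
  exact sub_self _

/-- `τ_{-1}` replaces the mode `t ^ r` by `(t - 1) ^ r`, that is, by an iterated difference. -/
theorem sum_shift_eq_fwdDiff (b : ℕ → Yangian D) (r : ℕ) :
    ∑ k ∈ Finset.range (r + 1), sc ((r.choose k : ℂ) * (-1) ^ (r - k)) • b k =
      ((fwdDiff 1)^[r] b) 0 := by
  rw [fwdDiff_iter_eq_sum_shift]
  refine Finset.sum_congr rfl fun k _ => ?_
  rw [← Int.cast_smul_eq_zsmul ℂ[X]]
  simp [mul_comm]

theorem shift_gen (c : ℂ) (k : Gen I 𝔥 ℕ) : shift D c (Alg.gen D ℕ k) = shiftGen D c k :=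
  Alg.lift_gen _ _ k

theorem shift_x (ε : ℤˣ) (i : I) (r : ℕ) : shift D (-1) (Alg.gen D ℕ (.x ε i r)) =
    ((fwdDiff 1)^[r] fun k => Alg.gen D ℕ (.x ε i k)) 0 := by
  rw [shift_gen]
  exact sum_shift_eq_fwdDiff D (fun k => Alg.gen D ℕ (.x ε i k)) r

theorem shift_h (i : I) (r : ℕ) : shift D (-1) (Alg.gen D ℕ (.h i r)) =
    ((fwdDiff 1)^[r] fun k => Alg.gen D ℕ (.h i k)) 0 := by
  rw [shift_gen]
  exact sum_shift_eq_fwdDiff D (fun k => Alg.gen D ℕ (.h i k)) r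

theorem shift_gen_mem (k : Gen I 𝔥 ℕ) : shift D (-1) (Alg.gen D ℕ k) ∈ Jplus D ^ k.deg := by
  have hJ := h_one_sub_h_zero_mem_Jplus D
  cases k with
  | cartan a => rw [Gen.deg, Submodule.pow_zero, Ideal.one_eq_top]; trivial
  | x ε i r =>
    rw [shift_x]
    exact fwdDiff_iter_x_mem (Jplus D) (RingHom.id _) (hbar_mem_Jplus D) hJ ε i r 0
  | h i r =>
    rw [shift_h]
    exact fwdDiff_iter_h_mem (Jplus D) (RingHom.id _) (hbar_mem_Jplus D) hJ i r 0

theorem shift_prod_mem (l : List (Gen I 𝔥 ℕ)) :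
    shift D (-1) (l.map (Alg.gen D ℕ)).prod ∈ Jplus D ^ (l.map Gen.deg).sum := by
  induction l with
  | nil =>
    rw [List.map_nil, List.sum_nil, Submodule.pow_zero, Ideal.one_eq_top]; trivial
  | cons k l ih =>
    rw [List.map_cons, List.map_cons, List.prod_cons, List.sum_cons, map_mul,
      Ideal.IsTwoSided.pow_add]
    exact Ideal.mul_mem_mul (shift_gen_mem D k) ih

theorem mem_of_mem_degGE (K : Ideal (Yangian D)) [K.IsTwoSided] (n : ℕ)
    (hK : ∀ (c : ℂ) (a : ℕ) (l : List (Gen I 𝔥 ℕ)), n ≤ a + (l.map Gen.deg).sum →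
      (sc c * hbar ^ a) • (l.map (Alg.gen D ℕ)).prod ∈ K) {y : Yangian D} (hy : y ∈ degGE D n) :
    y ∈ K := by
  have hle : TwoSidedIdeal.span {y | ∃ k, n ≤ k ∧ y ∈ gradedPiece D k} ≤ K.toTwoSided := by
    rw [TwoSidedIdeal.span_le]
    rintro y ⟨k, hk, hy⟩
    refine Ideal.mem_toTwoSided.2 ?_
    induction hy using AddSubgroup.closure_induction with
    | mem y h =>
      obtain ⟨c, a, l, rfl, rfl⟩ := h
      exact hK c a l hk
    | zero => exact zero_mem _
    | add a b _ _ ha hb => exact add_mem ha hb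
    | neg a _ ha => exact neg_mem ha
  exact Ideal.mem_toTwoSided.1 (hle (TwoSidedIdeal.mem_asIdeal.1 hy))

theorem Jplus_pow_le {m n : ℕ} (h : m ≤ n) : Jplus D ^ n ≤ Jplus D ^ m :=
  Ideal.pow_le_pow_right h

theorem shiftFiltered : ShiftFiltered D := by
  intro n y hy
  refine mem_of_mem_degGE D (K := (Jplus D ^ n).comap (shift D (-1)).toRingHom) n ?_ hy
  intro c a l h
  refine Ideal.mem_comap.2 (Jplus_pow_le D h ?_)
  change shift D (-1) _ ∈ _
  rw [map_smul, mul_smul, Algebra.smul_def, Algebra.smul_def, map_pow, Ideal.IsTwoSided.pow_add]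
  exact Ideal.mul_mem_left _ _ <|
    Ideal.mul_mem_mul (Ideal.pow_mem_pow (hbar_mem_Jplus D) a) (shift_prod_mem D l)

theorem degGE_zero : degGE D 0 = ⊤ := by
  rw [Ideal.eq_top_iff_one]
  simpa using monomial_mem_degGE D (n := 0) 1 0 [] (Nat.zero_le _)

/-- The additive span of the monomials of degree at least `n`; `degGE D n` is the two-sided ideal
that it generates. -/
def monomialSpan (n : ℕ) : AddSubgroup (Yangian D) :=
  AddSubgroup.closure {y | ∃ (c : ℂ) (a : ℕ) (l : List (Gen I 𝔥 ℕ)),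
    n ≤ a + (l.map Gen.deg).sum ∧ y = (sc c * hbar ^ a) • (l.map (Alg.gen D ℕ)).prod}

theorem monomialSpan_le {n : ℕ} {y : Yangian D} (hy : y ∈ monomialSpan D n) : y ∈ degGE D n := by
  induction hy using AddSubgroup.closure_induction with
  | mem y h =>
    obtain ⟨c, a, l, h, rfl⟩ := h
    exact monomial_mem_degGE D c a l h
  | zero => exact zero_mem _
  | add a b _ _ ha hb => exact add_mem ha hb
  | neg a _ ha => exact neg_mem ha

theorem mul_monomial_mem_monomialSpan {m n : ℕ} {y : Yangian D} (hy : y ∈ monomialSpan D m)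
    (c : ℂ) (a : ℕ) (l : List (Gen I 𝔥 ℕ)) (h : n ≤ a + (l.map Gen.deg).sum) :
    y * (sc c * hbar ^ a) • (l.map (Alg.gen D ℕ)).prod ∈ monomialSpan D (m + n) := by
  induction hy using AddSubgroup.closure_induction with
  | mem y hy =>
    obtain ⟨c', a', l', h', rfl⟩ := hy
    refine AddSubgroup.subset_closure ⟨c' * c, a' + a, l' ++ l, ?_, ?_⟩
    · rw [List.map_append, List.sum_append]; omega
    · rw [List.map_append, List.prod_append, smul_mul_smul_comm, sc, sc, sc, C_mul, pow_add]
      congr 1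
      ring
  | zero => rw [zero_mul]; exact zero_mem _
  | add a b _ _ ha hb => rw [add_mul]; exact add_mem ha hb
  | neg a _ ha => rw [neg_mul]; exact neg_mem ha

theorem mul_mem_monomialSpan {m : ℕ} {y : Yangian D} (hy : y ∈ monomialSpan D m)
    (w : Yangian D) : y * w ∈ monomialSpan D m := by
  induction w using Alg.induction generalizing y with
  | hs p =>
    induction p using Polynomial.induction_on' with
    | add p q hp hq => rw [map_add, mul_add]; exact add_mem hp hq
    | monomial n c =>
      have := mul_monomial_mem_monomialSpan D (n := 0) hy c n [] (Nat.zero_le _)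
      rwa [List.map_nil, List.prod_nil, C_mul_X_pow_eq_monomial, ← Algebra.algebraMap_eq_smul_one]
        at this
  | hg k =>
    simpa using mul_monomial_mem_monomialSpan D (n := 0) hy 1 0 [k] (Nat.zero_le _)
  | hadd a b ha hb => rw [mul_add]; exact add_mem (ha hy) (hb hy)
  | hmul a b ha hb => rw [← mul_assoc]; exact hb (ha hy)

theorem mul_mem_degGE {m n : ℕ} {y z : Yangian D} (hy : y ∈ degGE D m) (hz : z ∈ degGE D n) :
    y * z ∈ degGE D (m + n) := by
  -- The elements `z` for which the claim holds form a two-sided ideal, so `z` may be taken to be a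
  -- monomial. For fixed `z`, the elements `y` such that `y w z` has degree `≥ m + n` for all `w`
  -- form a two-sided ideal too, so `y` may be taken to be a monomial as well.
  let K : Ideal (Yangian D) :=
    { carrier := {z | ∀ y ∈ degGE D m, y * z ∈ degGE D (m + n)}
      add_mem' := fun ha hb y hy => by rw [mul_add]; exact add_mem (ha y hy) (hb y hy)
      zero_mem' := fun y _ => by rw [mul_zero]; exact zero_mem _
      smul_mem' := fun c a ha y hy => by
        rw [smul_eq_mul, ← mul_assoc]
        exact ha _ (Ideal.IsTwoSided.mul_mem_of_left _ hy) }
  have : K.IsTwoSided := ⟨fun {a} b ha y hy => by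
    rw [← mul_assoc]; exact Ideal.IsTwoSided.mul_mem_of_left _ (ha y hy)⟩
  refine mem_of_mem_degGE D K n (fun c a l h y hy => ?_) hz y hy
  let L : Ideal (Yangian D) :=
    { carrier := {y | ∀ w, y * w * (sc c * hbar ^ a) • (l.map (Alg.gen D ℕ)).prod ∈
        degGE D (m + n)}
      add_mem' := fun ha hb w => by rw [add_mul, add_mul]; exact add_mem (ha w) (hb w)
      zero_mem' := fun w => by rw [zero_mul, zero_mul]; exact zero_mem _
      smul_mem' := fun c a ha w => by
        rw [smul_eq_mul, mul_assoc, mul_assoc, ← mul_assoc a]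
        exact Ideal.mul_mem_left _ _ (ha w) }
  have : L.IsTwoSided := ⟨fun {a} b ha w => by rw [mul_assoc a]; exact ha (b * w)⟩
  have hL := mem_of_mem_degGE D L m (fun c' a' l' h' w => monomialSpan_le D <|
    mul_monomial_mem_monomialSpan D
      (mul_mem_monomialSpan D (AddSubgroup.subset_closure ⟨c', a', l', h', rfl⟩) w) c a l h) hy
  simpa using hL 1

end Filtrations

/-! ### The enveloping algebra in degree zero -/

section Section

attribute [local instance 100] LieRing.ofAssociativeRing

variable {D : Datum I 𝔥}

/-- The universal property of `U(𝔤)` in terms of the Chevalley-Serre presentation. -/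
theorem Datum.exists_algHom_U {B : Type*} [Ring B] [Algebra ℂ B] (φ : ChevalleyGen I 𝔥 → B)
    (hφ : ∀ x, D.Relator x → FreeLieAlgebra.lift ℂ φ x = 0) :
    ∃ σ : D.U →ₐ[ℂ] B, ∀ x, σ (D.toU x) = FreeLieAlgebra.lift ℂ φ x := by
  have hle : D.serreIdeal ≤ (FreeLieAlgebra.lift ℂ φ).ker :=
    LieSubmodule.lieSpan_le.2 fun x hx => LieHom.mem_ker.2 (hφ x hx)
  have hker : D.serreIdeal.toSubmodule ≤ (FreeLieAlgebra.lift ℂ φ : FreeLie I 𝔥 →ₗ[ℂ] B).ker :=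
    fun x hx => LieHom.mem_ker.1 (hle hx)
  let ψ : D.LieAlg →ₗ⁅ℂ⁆ B :=
    { toLinearMap := D.serreIdeal.toSubmodule.liftQ _ hker
      map_lie' := by
        intro x y
        obtain ⟨x, rfl⟩ := LieSubmodule.Quotient.surjective_mk' D.serreIdeal x
        obtain ⟨y, rfl⟩ := LieSubmodule.Quotient.surjective_mk' D.serreIdeal y
        exact LieHom.map_lie (FreeLieAlgebra.lift ℂ φ) x y }
  exact ⟨UniversalEnvelopingAlgebra.lift ℂ ψ, fun x => UniversalEnvelopingAlgebra.lift_ι_apply ℂ ψ _⟩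

theorem lieHom_ad_pow {L B : Type*} [LieRing L] [LieAlgebra ℂ L] [Ring B] [Algebra ℂ B]
    (φ : L →ₗ⁅ℂ⁆ B) (a b : L) (m : ℕ) :
    φ (((LieAlgebra.ad ℂ L a) ^ m) b) = nested (fun _ : Fin m => φ a) (φ b) := by
  induction m with
  | zero => simp [nested]
  | succ m ih =>
    rw [pow_succ', Module.End.mul_apply, LieAlgebra.ad_apply, LieHom.map_lie, ih]
    simp [nested]

/-- The Yangian as an algebra over the constants `ℂ ⊆ ℂ[ħ]`. -/
@[reducible] def yangianComplexAlgebra (D : Datum I 𝔥) : Algebra ℂ (Yangian D) :=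
  Algebra.compHom (Yangian D) (C : ℂ →+* ℂ[X])

attribute [local instance] yangianComplexAlgebra

theorem sc_smul_yangian (c : ℂ) (y : Yangian D) : sc c • y = c • y := rfl

theorem nested_x_zero (i j : I) (hij : i ≠ j) (ε : ℤˣ) :
    nested (fun _ : Fin (1 - D.A i j).toNat => Alg.gen D ℕ (.x ε i 0))
      (Alg.gen D ℕ (.x ε j 0)) = 0 := by
  have h := Alg.gen_rel _ _ (Rel.serre (D := D) (g := Alg.gen D ℕ) i j hij ε (fun _ => 0) 0)
  rw [Finset.sum_const, Finset.card_univ, Fintype.card_perm, Fintype.card_fin,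
    ← Nat.cast_smul_eq_nsmul ℂ] at h
  exact (smul_eq_zero_iff_right (Nat.cast_ne_zero.2 (Nat.factorial_ne_zero _))).1 h

/-- The images `h, x_{i0}^+ / √d_i, x_{i0}^- / √d_i` of the Chevalley generators `h, e_i, f_i` in the
Yangian. -/
def chevalleyImage (D : Datum I 𝔥) : ChevalleyGen I 𝔥 → Yangian D
  | .cartan a => Alg.gen D ℕ (.cartan a)
  | .e i => (((Real.sqrt (D.d i) : ℝ) : ℂ)⁻¹) • Alg.gen D ℕ (.x 1 i 0)
  | .f i => (((Real.sqrt (D.d i) : ℝ) : ℂ)⁻¹) • Alg.gen D ℕ (.x (-1) i 0)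

theorem lift_chevalleyImage_relator (x : FreeLie I 𝔥) (hx : D.Relator x) :
    FreeLieAlgebra.lift ℂ (chevalleyImage D) x = 0 := by
  have R : ∀ {a b : Yangian D}, Rel D (Alg.gen D ℕ) a b → a = b := fun h => Alg.gen_rel _ _ h
  have hs : ∀ i, ((Real.sqrt (D.d i) : ℝ) : ℂ) * ((Real.sqrt (D.d i) : ℝ) : ℂ) = D.d i := fun i => by
    rw [← Complex.ofReal_mul, Real.mul_self_sqrt (Nat.cast_nonneg _), Complex.ofReal_natCast]
  have hd : ∀ i, (D.d i : ℂ) ≠ 0 := fun i => Nat.cast_ne_zero.2 (D.d_pos i).ne'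
  cases hx with
  | add a b =>
    simp only [map_sub, map_add, FreeLieAlgebra.lift_of_apply, chevalleyImage]
    rw [R (.add a b), sub_self]
  | smul c a =>
    simp only [map_sub, map_smul, FreeLieAlgebra.lift_of_apply, chevalleyImage]
    rw [R (.smul c a), sc_smul_yangian, sub_self]
  | comm a b =>
    simp only [LieHom.map_lie, FreeLieAlgebra.lift_of_apply, chevalleyImage]
    exact R (.cartan_cartan a b)
  | cartan_e a i =>
    have := R (.cartan_x a 1 i 0)
    rw [sc_smul_yangian] at this
    simp only [map_sub, map_smul, LieHom.map_lie, FreeLieAlgebra.lift_of_apply, chevalleyImage]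
    rw [lie_smul, LieRing.of_associative_ring_bracket, ← Ring.lie_def, this, smul_comm]
    simp [sg]
  | cartan_f a i =>
    have := R (.cartan_x a (-1) i 0)
    rw [sc_smul_yangian] at this
    simp only [map_add, map_smul, LieHom.map_lie, FreeLieAlgebra.lift_of_apply, chevalleyImage]
    rw [lie_smul, LieRing.of_associative_ring_bracket, ← Ring.lie_def, this, smul_comm]
    simp [sg]
  | e_f i j =>
    have := R (.x_x i j 0 0)
    simp only [map_sub, LieHom.map_lie, FreeLieAlgebra.lift_of_apply, chevalleyImage]
    rw [lie_smul, smul_lie, LieRing.of_associative_ring_bracket, ← Ring.lie_def, this]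
    split_ifs with hij
    · subst hij
      rw [zero_add, R (.h_zero i), R (.smul _ _), sc_smul_yangian, smul_smul, smul_smul, ← mul_inv,
        hs, inv_mul_cancel₀ (hd i), one_smul, FreeLieAlgebra.lift_of_apply]
      exact sub_self _
    · rw [smul_zero, smul_zero, map_zero, sub_zero]
  | serre_e i j hij =>
    rw [lieHom_ad_pow]
    simp only [FreeLieAlgebra.lift_of_apply, chevalleyImage]
    rw [nested_smul, nested_smul_right, nested_x_zero i j hij, smul_zero, smul_zero]
  | serre_f i j hij =>
    rw [lieHom_ad_pow]
    simp only [FreeLieAlgebra.lift_of_apply, chevalleyImage]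
    rw [nested_smul, nested_smul_right, nested_x_zero i j hij, smul_zero, smul_zero]

variable (D) in
/-- The enveloping algebra maps to the degree-zero part of the Yangian: the relations between the
generators `h, x_{i0}^±` include the Chevalley-Serre relations. -/
theorem exists_section : ∃ σ : D.U →+* Yangian D,
    (∀ c : ℂ, σ (algebraMap ℂ D.U c) = algebraMap ℂ[X] (Yangian D) (C c)) ∧
    (∀ a, σ (D.toU (D.lc a)) = Alg.gen D ℕ (.cartan a)) ∧
    ∀ ε i, σ (D.ux ε i) = Alg.gen D ℕ (.x ε i 0) := by
  obtain ⟨σ, hσ⟩ := Datum.exists_algHom_U (chevalleyImage D) lift_chevalleyImage_relator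
  have hs : ∀ i, ((Real.sqrt (D.d i) : ℝ) : ℂ) ≠ 0 := fun i =>
    Complex.ofReal_ne_zero.2 (Real.sqrt_ne_zero'.2 (Nat.cast_pos.2 (D.d_pos i)))
  refine ⟨σ.toRingHom, fun c => σ.commutes c, fun a => ?_, fun ε i => ?_⟩
  · exact (hσ _).trans (FreeLieAlgebra.lift_of_apply _ _)
  · change σ (D.ux ε i) = _
    unfold Datum.ux
    rw [map_smul, hσ]
    rcases Int.units_eq_one_or ε with rfl | rfl
    · rw [if_pos rfl, FreeLieAlgebra.lift_of_apply, chevalleyImage, smul_smul,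
        mul_inv_cancel₀ (hs i), one_smul]
    · rw [if_neg (by decide), FreeLieAlgebra.lift_of_apply, chevalleyImage, smul_smul,
        mul_inv_cancel₀ (hs i), one_smul]

end Section

/-! ### Completions -/

section Completion

variable {A : Type*} [Ring A] {F : ℕ → Ideal A} [∀ n, (F n).IsTwoSided]

theorem Completion.proj_lift {B : Type*} [Ring B] {G : ℕ → Ideal B} [∀ n, (G n).IsTwoSided]
    (f : A →+* Completion G) (hf : ∀ n, ∀ a ∈ F n, Completion.proj G n (f a) = 0)
    {n : ℕ} {x : Completion F} {a : A} (h : Ideal.Quotient.mk (F n) a = Completion.proj F n x) :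
    Completion.proj G n (Completion.lift f hf x) = Completion.proj G n (f a) := by
  change Ideal.Quotient.lift (F n) ((Completion.proj G n).comp f) (hf n) (Completion.proj F n x) = _
  rw [← h, Ideal.Quotient.lift_mk]
  rfl

theorem Completion.exists_mk_eq_proj (n : ℕ) (x : Completion F) :
    ∃ a, Ideal.Quotient.mk (F n) a = Completion.proj F n x :=
  Ideal.Quotient.mk_surjective _

theorem Completion.mk_eq_proj_of_le {m n : ℕ} (h : m ≤ n) (hF : F n ≤ F m) {x : Completion F}
    {a : A} (ha : Ideal.Quotient.mk (F n) a = Completion.proj F n x) :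
    Ideal.Quotient.mk (F m) a = Completion.proj F m x := by
  obtain ⟨b, hb, hb'⟩ := x.2 m n h
  refine Eq.trans (Ideal.Quotient.eq.2 (hF (Ideal.Quotient.eq.1 ?_))) hb'
  exact ha.trans hb.symm

end Completion

/-! ### The homomorphism from the double -/

section Phi

variable (D : Datum I 𝔥)

theorem proj_Phi {n : ℕ} {x : Double D} {a : DoubleForm D}
    (h : Ideal.Quotient.mk (hbarIdeal D ^ n) a = Completion.proj (fun n => hbarIdeal D ^ n) n x) :
    CompletedYangian.proj D n (Phi D x) = CompletedYangian.proj D n (phiForm D a) :=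
  Completion.proj_lift (F := fun n => hbarIdeal D ^ n) (G := degGE D) (phiForm D).toRingHom
    (proj_phiForm_eq_zero D) h

theorem Phi_jmap (a : DoubleForm D) : Phi D (jmap D a) = phiForm D a :=
  Completion.ext fun _ => proj_Phi D rfl

theorem phiForm_gen (k : Gen I 𝔥 ℤ) : phiForm D (Alg.gen D ℤ k) = phiGen D k := Alg.lift_gen _ _ k

theorem proj_one_phiForm_eq_zero {a : DoubleForm D} (ha : eval D ℤ a = 0) :
    CompletedYangian.proj D 1 (phiForm D a) = 0 := by
  obtain ⟨σ, hσc, hσh, hσx⟩ := exists_section D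
  -- In degree zero, `Φ` is evaluation followed by the map from `U(𝔤)`.
  have key : CompletedYangian.proj D 1 (phiForm D a) =
      Ideal.Quotient.mk (degGE D 1) (σ (eval D ℤ a)) := by
    refine Alg.ringHom_ext (f := ((CompletedYangian.proj D 1).comp (phiForm D)).toRingHom)
      (g := (Ideal.Quotient.mk (degGE D 1)).comp (σ.comp (eval D ℤ))) (fun p => ?_) (fun k => ?_) a
    · change CompletedYangian.proj D 1 (phiForm D (algebraMap ℂ[X] _ p)) =
        Ideal.Quotient.mk (degGE D 1) (σ (eval D ℤ (algebraMap ℂ[X] _ p)))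
      rw [AlgHom.commutes, AlgHom.commutes, eval_algebraMap, hσc]
      refine mk_algebraMap_eq (F := degGE D) (hbar_pow_mem_degGE D) fun k hk => ?_
      obtain rfl : k = 0 := by omega
      rw [coeff_C_zero, coeff_zero_eq_eval_zero]
    · change CompletedYangian.proj D 1 (phiForm D (Alg.gen D ℤ k)) =
        Ideal.Quotient.mk (degGE D 1) (σ (eval D ℤ (Alg.gen D ℤ k)))
      rw [phiForm_gen, eval_gen]
      have hsum : ∀ (b : ℕ → Yangian D) (r : ℤ),
          ∑ n ∈ Finset.range 1, sc ((Ring.choose r n : ℤ) : ℂ) • b n = b 0 := fun b r => by simp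
      cases k with
      | cartan a => rw [evalGen, hσh]; rfl
      | x ε i r =>
        rw [evalGen, hσx]
        exact congrArg _ (hsum (fun n => Alg.gen D ℕ (.x ε i n)) r)
      | h i r =>
        rw [evalGen, hσh, ← Alg.gen_rel _ _ (Rel.h_zero (D := D) (g := Alg.gen D ℕ) i)]
        exact congrArg _ (hsum (fun n => Alg.gen D ℕ (.h i n)) r)
  rw [key, ha, map_zero, map_zero]

theorem phiFiltered : PhiFiltered D := by
  refine map_mem_of_mem_pow (J D) (fun n => RingHom.ker (CompletedYangian.proj D n))
    (Phi D).toRingHom ?_ ?_ ?_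
  · rw [Ideal.eq_top_iff_one]
    refine Ideal.Quotient.eq_zero_iff_mem.2 ?_
    rw [degGE_zero]
    trivial
  · intro n x hx y hy
    obtain ⟨a, ha, ha'⟩ := x.2 n (n + 1) n.le_succ
    obtain ⟨b, hb, hb'⟩ := y.2 1 (n + 1) (Nat.le_add_left _ _)
    have ha0 : a ∈ degGE D n := Ideal.Quotient.eq_zero_iff_mem.1 (ha'.trans hx)
    have hb0 : b ∈ degGE D 1 := Ideal.Quotient.eq_zero_iff_mem.1 (hb'.trans hy)
    refine RingHom.mem_ker.2 ?_
    rw [map_mul]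
    refine (congrArg₂ (· * ·) ha hb).symm.trans ?_
    exact (map_mul _ _ _).symm.trans (Ideal.Quotient.eq_zero_iff_mem.2 (mul_mem_degGE D ha0 hb0))
  · intro x hx
    obtain ⟨a, ha⟩ := Completion.exists_mk_eq_proj (F := fun n => hbarIdeal D ^ n) 1 x
    have he : eval D ℤ a = 0 := by
      have : evalDouble D x = 0 := hx
      change Ideal.Quotient.lift (hbarIdeal D ^ 1) (eval D ℤ) (eval_eq_zero_of_mem D)
        (Completion.proj (fun n => hbarIdeal D ^ n) 1 x) = 0 at this
      rwa [← ha, Ideal.Quotient.lift_mk] at this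
    exact RingHom.mem_ker.2 ((proj_Phi D ha).trans (proj_one_phiForm_eq_zero D he))

/-- An element of the double that vanishes modulo `ħ ^ n` is a multiple of `ħ ^ n`, although `ħ` is
not known to be a nonzerodivisor: the quotient is assembled from the increments of
approximations. -/
theorem mem_J_pow_of_proj_eq_zero (n : ℕ) (x : Double D)
    (hx : Completion.proj (fun n => hbarIdeal D ^ n) n x = 0) : x ∈ J D ^ n := by
  have hle : ∀ {m k}, m ≤ k → hbarIdeal D ^ k ≤ hbarIdeal D ^ m := fun h => Ideal.pow_le_pow_right h
  choose a ha using fun k =>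
    Completion.exists_mk_eq_proj (F := fun n => hbarIdeal D ^ n) (n + k) x
  have h0 : a 0 ∈ hbarIdeal D ^ n :=
    Ideal.Quotient.eq_zero_iff_mem.1 ((ha 0).trans hx)
  have h1 : ∀ k, a (k + 1) - a k ∈ hbarIdeal D ^ (n + k) := fun k =>
    Ideal.Quotient.eq.1 ((Completion.mk_eq_proj_of_le (F := fun n => hbarIdeal D ^ n)
      (Nat.le_succ _) (hle (Nat.le_succ _)) (ha (k + 1))).trans (ha k).symm)
  obtain ⟨c, hc⟩ := exists_eq_of_mem_hbarIdeal_pow D n h0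
  choose b hb using fun k => exists_eq_of_mem_hbarIdeal_pow D (n + k) (h1 k)
  let p : ℕ → DoubleForm D := fun N =>
    c + ∑ k ∈ Finset.range N, b k * algebraMap ℂ[X] (DoubleForm D) (hbar ^ k)
  have hp : ∀ N, p N * algebraMap ℂ[X] (DoubleForm D) (hbar ^ n) = a N := fun N => by
    rw [add_mul, ← hc, Finset.sum_mul, ← eq_sub_iff_add_eq', ← Finset.sum_range_sub]
    refine Finset.sum_congr rfl fun k _ => ?_
    rw [hb k, mul_assoc, ← map_mul, ← pow_add, add_comm k]
  let y : Double D := ⟨fun N => Ideal.Quotient.mk (hbarIdeal D ^ N) (p N), fun M N h =>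
    ⟨p N, rfl, by
      rw [Ideal.Quotient.eq, add_sub_add_left_eq_sub,
        ← Finset.sum_sdiff (Finset.range_subset_range.2 h), add_sub_cancel_right]
      refine Ideal.sum_mem _ fun k hk => Ideal.mul_mem_left _ _ ?_
      rw [Finset.mem_sdiff, Finset.mem_range, Finset.mem_range, not_lt] at hk
      rw [map_pow]
      exact hle hk.2 (Ideal.pow_mem_pow (hbar_mem_hbarIdeal D) k)⟩⟩
  have hy : x = y * jmap D (algebraMap ℂ[X] (DoubleForm D) hbar) ^ n := by
    rw [← map_pow, ← map_pow]
    refine Completion.ext (F := fun n => hbarIdeal D ^ n) fun N => ?_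
    have e : Completion.proj (fun n => hbarIdeal D ^ n) N
        (y * jmap D (algebraMap ℂ[X] (DoubleForm D) (hbar ^ n))) =
        Ideal.Quotient.mk (hbarIdeal D ^ N)
          (p N * algebraMap ℂ[X] (DoubleForm D) (hbar ^ n)) := rfl
    rw [e, hp]
    exact (Completion.mk_eq_proj_of_le (F := fun n => hbarIdeal D ^ n) (Nat.le_add_left _ _)
      (hle (Nat.le_add_left _ _)) (ha N)).symm
  rw [hy]
  exact Ideal.mul_mem_left _ _ (Ideal.pow_mem_pow (hbar_mem_J D) n)

theorem mk_J_pow_eq_of_proj_eq {n : ℕ} {x y : Double D}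
    (h : Completion.proj (fun n => hbarIdeal D ^ n) n x =
      Completion.proj (fun n => hbarIdeal D ^ n) n y) :
    Ideal.Quotient.mk (J D ^ n) x = Ideal.Quotient.mk (J D ^ n) y :=
  Ideal.Quotient.eq.2 <| mem_J_pow_of_proj_eq_zero D n _ <|
    (map_sub (Completion.proj (fun n => hbarIdeal D ^ n) n) x y).trans (sub_eq_zero.2 h)

end Phi

/-! ### The shift automorphisms -/

section Shift

variable (D : Datum I 𝔥)

theorem umbral_comp_shift {B : Type*} [Ring B] [Algebra ℂ[X] B] (f : B →ₐ[ℂ[X]] B) (b : ℕ → B)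
    (c : ℂ) (hf : ∀ r, f (b r) = umbral b ((X + C (sc c)) ^ r)) (p : ℂ[X][X]) :
    f (umbral b p) = umbral b (p.comp (X + C (sc c))) := by
  induction p using Polynomial.induction_on' with
  | add p q hp hq => rw [map_add, map_add, hp, hq, add_comp, map_add]
  | monomial n d =>
    rw [umbral_monomial, map_smul, hf, monomial_comp, ← smul_eq_C_mul, map_smul]

theorem shift_shift {c c' : ℂ} (h : c + c' = 0) (y : Yangian D) : shift D c (shift D c' y) = y := by
  refine Alg.ringHom_ext (f := ((shift D c).comp (shift D c')).toRingHom)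
    (g := RingHom.id _) (fun p => ?_) (fun k => ?_) y
  · exact AlgHom.commutes ((shift D c).comp (shift D c')) p
  · have key : ∀ b : ℕ → Yangian D,
        (∀ r, shift D c (b r) = umbral b ((X + C (sc c)) ^ r)) → ∀ r,
        shift D c (umbral b ((X + C (sc c')) ^ r)) = b r := fun b hb r => by
      rw [umbral_comp_shift _ b c hb, pow_comp, add_comp, X_comp, C_comp, add_assoc, ← C_add, sc, sc,
        ← C_add, h, C_0, C_0, add_zero, X_pow_eq_monomial, umbral_monomial, one_smul]
    change shift D c (shift D c' (Alg.gen D ℕ k)) = Alg.gen D ℕ k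
    have hs : ∀ c k, shift D c (Alg.gen D ℕ k) =
        umbralGen (Alg.gen D ℕ) (fun r => (X + C (sc c)) ^ r) k := fun c k => by
      rw [shift_gen, shiftGen_eq]
    cases k with
    | cartan a => rw [hs]; exact hs _ _
    | x ε i r =>
      rw [hs]
      exact key (fun r => Alg.gen D ℕ (.x ε i r)) (fun r => hs c _) r
    | h i r =>
      rw [hs]
      exact key (fun r => Alg.gen D ℕ (.h i r)) (fun r => hs c _) r

/-- For `r ≥ 0` the series `∑_n (r choose n) b_n` is a finite sum. -/
theorem binomSum_natCast (b : ℕ → Yangian D) (hb : ∀ m n, m ≤ n → b n ∈ degGE D m) (r : ℕ) :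
    binomSum D b hb r = Completion.of (degGE D)
      (∑ k ∈ Finset.range (r + 1), sc ((r.choose k : ℂ) * 1 ^ (r - k)) • b k) := by
  refine Completion.ext fun N => ?_
  change Ideal.Quotient.mk (degGE D N) _ = Ideal.Quotient.mk (degGE D N) _
  have hc : ∀ k, sc ((Ring.choose (r : ℤ) k : ℤ) : ℂ) • b k =
      sc ((r.choose k : ℂ) * 1 ^ (r - k)) • b k := fun k => by
    rw [Ring.choose_natCast, one_pow, mul_one, Int.cast_natCast]
  simp only [hc]
  have h1 : ∑ k ∈ Finset.range (r + 1), sc ((r.choose k : ℂ) * 1 ^ (r - k)) • b k =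
      ∑ k ∈ Finset.range (N + (r + 1)), sc ((r.choose k : ℂ) * 1 ^ (r - k)) • b k := by
    refine Finset.sum_subset (Finset.range_subset_range.2 (Nat.le_add_left _ _)) fun k _ hk => ?_
    rw [Finset.mem_range, not_lt] at hk
    rw [Nat.choose_eq_zero_of_lt hk, Nat.cast_zero, zero_mul, sc, C_0, zero_smul]
  rw [h1, eq_comm, Ideal.Quotient.eq,
    ← Finset.sum_sdiff (Finset.range_subset_range.2 (Nat.le_add_right N (r + 1))),
    add_sub_cancel_right]
  refine Ideal.sum_mem _ fun k hk => ?_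
  rw [Finset.mem_sdiff, Finset.mem_range, Finset.mem_range, not_lt] at hk
  rw [Algebra.smul_def]
  exact Ideal.mul_mem_left _ _ (hb N k hk.2)

theorem Phi_iota (y : Yangian D) : Phi D (iota D y) = Completion.of (degGE D) (shift D 1 y) := by
  refine (Phi_jmap D _).trans ?_
  refine Alg.ringHom_ext (f := ((phiForm D).comp (iotaForm D)).toRingHom)
    (g := (Completion.of (degGE D)).comp (shift D 1).toRingHom) (fun p => ?_) (fun k => ?_) y
  · refine (AlgHom.commutes ((phiForm D).comp (iotaForm D)) p).trans ?_
    exact (congrArg (Completion.of (degGE D)) (AlgHom.commutes (shift D 1) p)).symm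
  · change phiForm D (iotaForm D (Alg.gen D ℕ k)) =
      Completion.of (degGE D) (shift D 1 (Alg.gen D ℕ k))
    rw [iotaForm_gen, phiForm_gen, shift_gen]
    cases k with
    | cartan a => rfl
    | x ε i r =>
      exact binomSum_natCast D (fun r => Alg.gen D ℕ (.x ε i r))
        (fun _ _ h => gen_mem_degGE D _ h) r
    | h i r =>
      exact binomSum_natCast D (fun r => Alg.gen D ℕ (.h i r))
        (fun _ _ h => gen_mem_degGE D _ h) r

theorem shift_one_mem_degGE (n : ℕ) (y : Yangian D) (hy : y ∈ Jplus D ^ n) :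
    shift D 1 y ∈ degGE D n := by
  have := phiFiltered D n _ (iotaFiltered D n y hy)
  rw [Phi_iota] at this
  exact Ideal.Quotient.eq_zero_iff_mem.1 this

/-- The inverse of `Γ̂`, induced by `τ_1`. -/
def gammaHatInv : EvalCompletedYangian D →+* CompletedYangian D :=
  Completion.lift (F := fun n => Jplus D ^ n) ((Completion.of (degGE D)).comp (shift D 1).toRingHom)
    fun n a ha => Ideal.Quotient.eq_zero_iff_mem.2 (shift_one_mem_degGE D n a ha)

end Shift

/-! ### The induced maps of completions -/

section Induced

variable (D : Datum I 𝔥)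

theorem proj_gammaHat {n : ℕ} {x : CompletedYangian D} {y : Yangian D}
    (h : Ideal.Quotient.mk (degGE D n) y = Completion.proj (degGE D) n x) :
    Ideal.Quotient.mk (Jplus D ^ n) (shift D (-1) y) =
      Completion.proj (fun n => Jplus D ^ n) n (gammaHat (shiftFiltered D) x) :=
  (Completion.proj_lift (F := degGE D) (G := fun n => Jplus D ^ n)
    ((Completion.of fun n => Jplus D ^ n).comp (shift D (-1)).toRingHom) _ h).symm

theorem proj_gammaHatInv {n : ℕ} {x : EvalCompletedYangian D} {y : Yangian D}
    (h : Ideal.Quotient.mk (Jplus D ^ n) y = Completion.proj (fun n => Jplus D ^ n) n x) :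
    Ideal.Quotient.mk (degGE D n) (shift D 1 y) = Completion.proj (degGE D) n (gammaHatInv D x) :=
  (Completion.proj_lift (F := fun n => Jplus D ^ n) (G := degGE D)
    ((Completion.of (degGE D)).comp (shift D 1).toRingHom) _ h).symm

theorem proj_iotaHat {n : ℕ} {x : EvalCompletedYangian D} {y : Yangian D}
    (h : Ideal.Quotient.mk (Jplus D ^ n) y = Completion.proj (fun n => Jplus D ^ n) n x) :
    Ideal.Quotient.mk (J D ^ n) (iota D y) =
      Completion.proj (fun n => J D ^ n) n (iotaHat (iotaFiltered D) x) :=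
  (Completion.proj_lift (F := fun n => Jplus D ^ n) (G := fun n => J D ^ n)
    ((Completion.of fun n => J D ^ n).comp (iota D)) _ h).symm

theorem proj_phiHat {n : ℕ} {x : CompletedDouble D} {a : Double D}
    (h : Ideal.Quotient.mk (J D ^ n) a = Completion.proj (fun n => J D ^ n) n x) :
    CompletedYangian.proj D n (phiHat (phiFiltered D) x) = CompletedYangian.proj D n (Phi D a) :=
  Completion.proj_lift (F := fun n => J D ^ n) (G := degGE D) _ _ h

theorem gammaHat_gammaHatInv (x : EvalCompletedYangian D) :
    gammaHat (shiftFiltered D) (gammaHatInv D x) = x := by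
  refine Completion.ext (F := fun n => Jplus D ^ n) fun n => ?_
  obtain ⟨y, hy⟩ := Completion.exists_mk_eq_proj (F := fun n => Jplus D ^ n) n x
  rw [← proj_gammaHat D (proj_gammaHatInv D hy), shift_shift D (neg_add_cancel 1), hy]

theorem gammaHatInv_gammaHat (x : CompletedYangian D) :
    gammaHatInv D (gammaHat (shiftFiltered D) x) = x := by
  refine Completion.ext (F := degGE D) fun n => ?_
  obtain ⟨y, hy⟩ := Completion.exists_mk_eq_proj (F := degGE D) n x
  rw [← proj_gammaHatInv D (proj_gammaHat D hy), shift_shift D (add_neg_cancel 1), hy]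

theorem gammaHat_phiHat_iotaHat (x : EvalCompletedYangian D) :
    gammaHat (shiftFiltered D) (phiHat (phiFiltered D) (iotaHat (iotaFiltered D) x)) = x := by
  refine Completion.ext (F := fun n => Jplus D ^ n) fun n => ?_
  obtain ⟨y, hy⟩ := Completion.exists_mk_eq_proj (F := fun n => Jplus D ^ n) n x
  have h := proj_phiHat D (proj_iotaHat D hy)
  rw [Phi_iota] at h
  rw [← proj_gammaHat D h.symm, shift_shift D (neg_add_cancel 1), hy]

theorem fwdDiff_iter_natCast {B : Type*} [AddCommGroup B] (b : ℤ → B) (k : ℕ) :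
    ((fwdDiff 1)^[k] fun r : ℕ => b r) 0 = ((fwdDiff 1)^[k] b) 0 := by
  rw [fwdDiff_iter_eq_sum_shift, fwdDiff_iter_eq_sum_shift]
  simp

/-- Modulo `𝒥 ^ n`, applying `ι ∘ τ_{-1}` to the truncation of `∑_k (r choose k) b_k` gives Newton's
expansion of the `r`-th mode, in which all differences of order `n` vanish. -/
theorem iota_shift_sum (b : ℕ → Yangian D) (u : ℤ → Double D) (n : ℕ)
    (hu : ∀ s, ((fwdDiff 1)^[n] u) s ∈ J D ^ n)
    (hb : ∀ k, shift D (-1) (b k) = ((fwdDiff 1)^[k] b) 0) (hbu : ∀ k : ℕ, iota D (b k) = u k)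
    (r : ℤ) :
    Ideal.Quotient.mk (J D ^ n) (iota D (shift D (-1)
      (∑ k ∈ Finset.range n, sc ((Ring.choose r k : ℤ) : ℂ) • b k))) =
    Ideal.Quotient.mk (J D ^ n) (u r) := by
  have hk : ∀ k, Ideal.Quotient.mk (J D ^ n) (iota D (shift D (-1) (b k))) =
      ((fwdDiff 1)^[k] fun r => Ideal.Quotient.mk (J D ^ n) (u r)) 0 := fun k => by
    rw [hb, ← fwdDiff_iter_natCast]
    simp only [← hbu]
    exact (fwdDiff_iter_map ((Ideal.Quotient.mk (J D ^ n)).comp (iota D)).toAddMonoidHom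
      1 b k 0).symm
  rw [map_sum, map_sum, map_sum]
  refine Eq.trans (Finset.sum_congr rfl fun k _ => ?_)
    (eq_sum_choose_fwdDiff n (fun r => Ideal.Quotient.mk (J D ^ n) (u r)) (fun s => ?_) r).symm
  · have : sc ((Ring.choose r k : ℤ) : ℂ) • b k = Ring.choose r k • b k := by
      rw [← Int.cast_smul_eq_zsmul ℂ[X]]
      simp
    rw [this, map_zsmul, map_zsmul, map_zsmul, hk]
  · exact (fwdDiff_iter_map (Ideal.Quotient.mk (J D ^ n)).toAddMonoidHom 1 u n s).trans
      (Ideal.Quotient.eq_zero_iff_mem.2 (hu s))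

/-- The map `Y / ⨁_{k ≥ n} Y_k → DY / 𝒥 ^ n` induced by `ι ∘ τ_{-1}`. -/
def iotaShift (n : ℕ) : Yangian D ⧸ degGE D n →+* Double D ⧸ J D ^ n :=
  Ideal.Quotient.lift (degGE D n)
    ((Ideal.Quotient.mk (J D ^ n)).comp ((iota D).comp (shift D (-1)).toRingHom))
    fun y hy => Ideal.Quotient.eq_zero_iff_mem.2 (iotaFiltered D n _ (shiftFiltered D n y hy))

theorem iotaShift_phiForm (n : ℕ) (a : DoubleForm D) :
    iotaShift D n (CompletedYangian.proj D n (phiForm D a)) =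
      Ideal.Quotient.mk (J D ^ n) (jmap D a) := by
  refine Alg.ringHom_ext
    (f := (iotaShift D n).comp ((CompletedYangian.proj D n).comp (phiForm D)).toRingHom)
    (g := (Ideal.Quotient.mk (J D ^ n)).comp (jmap D)) (fun p => ?_) (fun k => ?_) a
  · refine (congrArg (iotaShift D n)
      (AlgHom.commutes ((CompletedYangian.proj D n).comp (phiForm D)) p)).trans ?_
    change Ideal.Quotient.mk (J D ^ n)
      (jmap D (iotaForm D (shift D (-1) (algebraMap ℂ[X] _ p)))) = _
    rw [AlgHom.commutes, AlgHom.commutes]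
    rfl
  · have hJ := h_one_sub_h_zero_mem_J D
    change iotaShift D n (CompletedYangian.proj D n (phiForm D (Alg.gen D ℤ k))) =
      Ideal.Quotient.mk (J D ^ n) (jmap D (Alg.gen D ℤ k))
    have hι : ∀ k, iota D (Alg.gen D ℕ k) = jmap D (Alg.gen D ℤ (castGen k)) :=
      fun k => congrArg (jmap D) (iotaForm_gen D k)
    rw [phiForm_gen]
    cases k with
    | cartan a =>
      change Ideal.Quotient.mk (J D ^ n) (iota D (shift D (-1) (Alg.gen D ℕ (.cartan a)))) = _
      rw [shift_gen]
      exact congrArg _ (hι (.cartan a))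
    | x ε i r =>
      exact iota_shift_sum D (fun k => Alg.gen D ℕ (.x ε i k))
        (fun r => jmap D (Alg.gen D ℤ (.x ε i r))) n
        (fwdDiff_iter_x_mem (J D) (jmap D) (hbar_mem_J D) hJ ε i n) (shift_x D ε i)
        (fun k => hι (.x ε i k)) r
    | h i r =>
      exact iota_shift_sum D (fun k => Alg.gen D ℕ (.h i k))
        (fun r => jmap D (Alg.gen D ℤ (.h i r))) n
        (fwdDiff_iter_h_mem (J D) (jmap D) (hbar_mem_J D) hJ i n) (shift_h D i)
        (fun k => hι (.h i k)) r

theorem iotaShift_Phi (n : ℕ) (x : Double D) :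
    iotaShift D n (CompletedYangian.proj D n (Phi D x)) = Ideal.Quotient.mk (J D ^ n) x := by
  -- Modulo `ħ ^ n ∈ 𝒥 ^ n` the element `x` comes from the `ℂ[ħ]`-form.
  obtain ⟨a, ha⟩ := Completion.exists_mk_eq_proj (F := fun n => hbarIdeal D ^ n) n x
  rw [proj_Phi D ha, iotaShift_phiForm]
  exact mk_J_pow_eq_of_proj_eq D ha

theorem iotaHat_gammaHat_phiHat (x : CompletedDouble D) :
    iotaHat (iotaFiltered D) (gammaHat (shiftFiltered D) (phiHat (phiFiltered D) x)) = x := by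
  refine Completion.ext (F := fun n => J D ^ n) fun n => ?_
  obtain ⟨a, ha⟩ := Completion.exists_mk_eq_proj (F := fun n => J D ^ n) n x
  obtain ⟨y, hy⟩ := Completion.exists_mk_eq_proj (F := degGE D) n (phiHat (phiFiltered D) x)
  have h := iotaShift_Phi D n a
  rw [← proj_phiHat D ha] at h
  rw [← proj_iotaHat D (proj_gammaHat D hy), ← ha, ← h]
  change _ = iotaShift D n (Completion.proj (degGE D) n (phiHat (phiFiltered D) x))
  rw [← hy]
  rfl

theorem iotaHat_algebraMap (f : PowerSeries ℂ) :
    iotaHat (iotaFiltered D) (algebraMap _ (EvalCompletedYangian D) f) =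
      algebraMap _ (CompletedDouble D) f := by
  refine Completion.ext (F := fun n => J D ^ n) fun n => ?_
  have h : Ideal.Quotient.mk (Jplus D ^ n) (algebraMap ℂ[X] (Yangian D) (PowerSeries.trunc n f)) =
      Completion.proj (fun n => Jplus D ^ n) n (algebraMap _ (EvalCompletedYangian D) f) := rfl
  rw [← proj_iotaHat D h]
  change _ = Ideal.Quotient.mk (J D ^ n) (algebraMap (PowerSeries ℂ) (Double D) f)
  refine mk_J_pow_eq_of_proj_eq D ?_
  change Ideal.Quotient.mk (hbarIdeal D ^ n) (iotaForm D (algebraMap ℂ[X] (Yangian D) _)) = _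
  rw [AlgHom.commutes]
  rfl

theorem gammaHat_algebraMap (f : PowerSeries ℂ) :
    gammaHat (shiftFiltered D) (algebraMap _ (CompletedYangian D) f) =
      algebraMap _ (EvalCompletedYangian D) f := by
  refine Completion.ext (F := fun n => Jplus D ^ n) fun n => ?_
  have h : Ideal.Quotient.mk (degGE D n) (algebraMap ℂ[X] (Yangian D) (PowerSeries.trunc n f)) =
      Completion.proj (degGE D) n (algebraMap _ (CompletedYangian D) f) := rfl
  rw [← proj_gammaHat D h, AlgHom.commutes]
  rfl

theorem phiHat_algebraMap (f : PowerSeries ℂ) :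
    phiHat (phiFiltered D) (algebraMap _ (CompletedDouble D) f) =
      algebraMap _ (CompletedYangian D) f := by
  refine Completion.ext (F := degGE D) fun n => ?_
  have h : Ideal.Quotient.mk (J D ^ n) (algebraMap (PowerSeries ℂ) (Double D) f) =
      Completion.proj (fun n => J D ^ n) n (algebraMap _ (CompletedDouble D) f) := rfl
  refine (proj_phiHat D h).trans ?_
  rw [AlgHom.commutes]
  rfl

end Induced

end

end KacMoodyYangian

theorem corollary5p7 {I 𝔥 : Type*} [Fintype I] [DecidableEq I] [AddCommGroup 𝔥] [Module ℂ 𝔥]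
    (D : KacMoodyYangian.Datum I 𝔥) :
    ∃ (hι : KacMoodyYangian.IotaFiltered D) (hΓ : KacMoodyYangian.ShiftFiltered D)
      (hΦ : KacMoodyYangian.PhiFiltered D)
      (ιhat : KacMoodyYangian.EvalCompletedYangian D ≃ₐ[PowerSeries ℂ]
        KacMoodyYangian.CompletedDouble D)
      (Γhat : KacMoodyYangian.CompletedYangian D ≃ₐ[PowerSeries ℂ]
        KacMoodyYangian.EvalCompletedYangian D)
      (Φhat : KacMoodyYangian.CompletedDouble D →ₐ[PowerSeries ℂ]
        KacMoodyYangian.CompletedYangian D),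
      (∀ y, ιhat y = KacMoodyYangian.iotaHat hι y) ∧
      (∀ y, Γhat y = KacMoodyYangian.gammaHat hΓ y) ∧
      (∀ x, Φhat x = KacMoodyYangian.phiHat hΦ x) ∧
      ∀ x, ιhat.symm x = Γhat (Φhat x) := by
  have hι := KacMoodyYangian.iotaFiltered D
  have hΓ := KacMoodyYangian.shiftFiltered D
  have hΦ := KacMoodyYangian.phiFiltered D
  refine ⟨hι, hΓ, hΦ,
    AlgEquiv.ofRingEquiv (f := RingEquiv.ofRingHom (KacMoodyYangian.iotaHat hι)
      ((KacMoodyYangian.gammaHat hΓ).comp (KacMoodyYangian.phiHat hΦ))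
      (RingHom.ext (KacMoodyYangian.iotaHat_gammaHat_phiHat D))
      (RingHom.ext (KacMoodyYangian.gammaHat_phiHat_iotaHat D)))
      (KacMoodyYangian.iotaHat_algebraMap D),
    AlgEquiv.ofRingEquiv (f := RingEquiv.ofRingHom (KacMoodyYangian.gammaHat hΓ)
      (KacMoodyYangian.gammaHatInv D) (RingHom.ext (KacMoodyYangian.gammaHat_gammaHatInv D))
      (RingHom.ext (KacMoodyYangian.gammaHatInv_gammaHat D)))
      (KacMoodyYangian.gammaHat_algebraMap D),
    { KacMoodyYangian.phiHat hΦ with commutes' := KacMoodyYangian.phiHat_algebraMap D },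
    fun _ => rfl, fun _ => rfl, fun _ => rfl, fun _ => rfl⟩
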